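/- **Theorem (Error estimate).** Let $\Omega=[a,b]$, $a<b$, $T>0$, $k\ge 0$, $C>1$, $c_0\ge 0$. Let $u$ be a smooth ($C^\infty$ up to $t=0$ and $t=T$) solution of $u_t+u_x=0$ on $\Omega\times[0,T]$ with either periodic boundary conditions ($u(\cdot,t)$ extends to a smooth $(b-a)$-periodic function on $\mathbb R$) or compactly supported ones ($u(\cdot,t)$, extended by zero, is smooth with support in $(a,b)$ for all $t\in[0,T]$). Put $f(u)=u$, $U(u)=u^2/2$, $F(u)=u^2/2$, $v(u)=U'(u)$, $A(u)=U''(u)^{-1}$. *Mesh.* For $N\ge1$ let $h=(b-a)/N$, $x_{i+1/2}=a+ih$ ($0\le i\le N$), $K_i=[x_{i-1/2},x_{i+1/2}]$ with center $x_i$, and $V_h^k=\{w: w|_{K_i}\in P^k(K_i),\ 1\le i\le N\}$. Let $w^\pm_{i+1/2}$ be the limits of $w$ at $x_{i+1/2}$ from the right and from the left and $[\![w]\!]=w^+-w^-$. The exterior limits at $x_{1/2}$ and $x_{N+1/2}$ are taken from the periodic extension of $w$ in the periodic case, and are $0$ in the compactly supported case. *Fluxes.* $\hat f=\hat f^C+\hat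 f^D$ with $\hat f^C(u^-,u^+)=\frac12(f(u^+)+f(u^-))$ and $\hat f^D(u^-,u^+)=-\frac12\alpha(u^+-u^-)$, where $\alpha$ is the maximum of $|f'|$ between $u^-$ and $u^+$; and $\hat F(u^-,u^+)=\frac12(F(u^+)+F(u^-))$. Fluxes with index $i\pm1/2$ are evaluated at the one-sided limits of $u_h$ there. *Viscosity.* Let $\nu_i(x)=1-\big(\tfrac{x-x_i}{h/2}\big)^2$, let $v_h\in V_h^k$ interpolate $v(u_h)$ on each cell at the $k+1$ Gauss–Lobatto points (for $k=0$ the choice of $v_h$ is irrelevant, since the viscous term below vanishes), and $$E_i=\int_{K_i}\nu_i\,(v_h)_xA(u_h)(v_h)_x\,dx,\qquad F_i=\hat F_{i+1/2}-\hat F_{i-1/2}-\hat f^C_{i+1/2}(v_h)^-_{i+1/2}+\hat f^C_{i-1/2}(v_h)^+_{i-1/2}+\int_{K_i}f(u_h)(v_h)_x\,dx,$$ $$\sigma_i^{jump}=c_0\max_{K_i}|f'(u_h)|\Big(h\,\|[\![u_h]\!]\|_{\partial K_i}+\sum_{l=1}^k l(l+1)h^{l+1}\|[\![\partial_x^lu_h]\!]\|_{\partial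 K_i}\Big),$$ where $\|[\![w]\!]\|_{\partial K_i}=|[\![w]\!]_{i-1/2}|+|[\![w]\!]_{i+1/2}|$, and $$\sigma_i^{entropy}=\min\Big\{\max\Big\{\frac{F_i}{E_i},0\Big\},\,C\sigma_i^{jump}\Big\},\qquad \sigma_i=\max\{\sigma_i^{jump},\sigma_i^{entropy}\}$$ (with $F_i/E_i:=0$ if $E_i=0$; the viscous term below is then zero anyway). *Scheme.* A solution of the semi-discrete NOES-DG scheme is a differentiable map $t\mapsto u_h(\cdot,t)\in V_h^k$ on $[0,T]$ such that, for all $t\in[0,T]$, all $w\in V_h^k$ and all $i$, $$\int_{K_i}\frac{\partial u_h}{\partial t}w\,dx=\int_{K_i}f(u_h)w_x\,dx-\hat f_{i+1/2}w^-_{i+1/2}+\hat f_{i-1/2}w^+_{i-1/2}-\sigma_i\int_{K_i}\nu_i\,(v_h)_xA(u_h)\,w_x\,dx,$$ with the $L^2$-projected initial data $\int_{K_i}u_h(x,0)w\,dx=\int_{K_i}u(x,0)w\,dx$ for all $w\in V_h^k$ and all $i$. *Conclusion.* There is a constant $M>0$, which may depend on $a,b,T,k,C,c_0$, the type of boundary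 condition and $u$, but not on $N$ (that is, on $h$), on $u_h$ or on $t$, such that for every $N\ge1$, every solution $u_h$ of the scheme and every $t\in[0,T]$, $$\|u(\cdot,t)-u_h(\cdot,t)\|_{L^2(\Omega)}\le M\,h^{k+1}.$$ -/

import Mathlib

open scoped Polynomial ContDiff

namespace NOESDG

noncomputable section

/-- A scalar flux `f` in one space dimension together with an entropy pair `(U, F)`,
`F' = U' f'`. -/
structure EntropyLaw where
  f : ℝ → ℝ
  U : ℝ → ℝ
  F : ℝ → ℝ
  entropy_pair : ∀ s : ℝ, deriv F s = deriv U s * deriv f s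

/-- Linear advection `f(u) = u` with the square entropy `U(u) = u²/2`, whose entropy flux is
`F(u) = u²/2`. -/
def linearSquare : EntropyLaw where
  f := fun s => s
  U := fun s => s ^ 2 / 2
  F := fun s => s ^ 2 / 2
  entropy_pair := by intro s; simp

/-- The two kinds of boundary conditions. -/
inductive BoundaryCondition
  | periodic
  | compactSupport

/-- `u` is a smooth solution of `u_t + f(u)_x = 0` on `[a,b] × [0,T]`, extended in `x` to the
whole line: `(b-a)`-periodically for periodic boundary conditions, and by zero for compactly
supported ones (in which case the support of `u(·,t)` stays inside the open interval). -/
structure IsSmoothSolution (f : ℝ → ℝ) (a b T : ℝ) (bc : BoundaryCondition)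
    (u : ℝ → ℝ → ℝ) : Prop where
  smooth : ContDiffOn ℝ ∞ (fun p : ℝ × ℝ => u p.1 p.2) (Set.univ ×ˢ Set.Icc 0 T)
  pde : ∀ x : ℝ, ∀ t ∈ Set.Ioo 0 T,
    deriv (fun s => u x s) t + deriv (fun y => f (u y t)) x = 0
  boundary : match bc with
    | .periodic => ∀ x : ℝ, ∀ t ∈ Set.Icc 0 T, u (x + (b - a)) t = u x t
    | .compactSupport => ∀ t ∈ Set.Icc 0 T, tsupport (fun x => u x t) ⊆ Set.Ioo a b

/-! ### The uniform mesh with `N` cells -/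

/-- Mesh size `h`. -/
def meshSize (a b : ℝ) (N : ℕ) : ℝ := (b - a) / N

/-- Left end point of the cell with (zero-based) number `i`. -/
def xL (a b : ℝ) {N : ℕ} (i : Fin N) : ℝ := a + (i : ℕ) * meshSize a b N

/-- Right end point of the cell with number `i`. -/
def xR (a b : ℝ) {N : ℕ} (i : Fin N) : ℝ := a + ((i : ℕ) + 1) * meshSize a b N

/-- Center of the cell with number `i`. -/
def xC (a b : ℝ) {N : ℕ} (i : Fin N) : ℝ := (xL a b i + xR a b i) / 2

/-- The space `V_h^k`. A discontinuous piecewise polynomial is given by its polynomial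
(in the physical variable `x`) on each cell. -/
def DGSpace (N k : ℕ) : Set (Fin N → ℝ[X]) := {w | ∀ i, (w i).natDegree ≤ k}

/-! ### One-sided limits at the cell interfaces -/

/-- `w⁺` at the left end of cell `i` (limit from inside the cell). -/
def innerL (a b : ℝ) {N : ℕ} (w : Fin N → ℝ[X]) (i : Fin N) : ℝ := (w i).eval (xL a b i)

/-- `w⁻` at the right end of cell `i` (limit from inside the cell). -/
def innerR (a b : ℝ) {N : ℕ} (w : Fin N → ℝ[X]) (i : Fin N) : ℝ := (w i).eval (xR a b i)

/-- `w⁻` at the left end of cell `i`: the limit from the neighbouring cell on the left. At `x = a`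
the neighbour is the last cell (`i - 1` is cyclic in `Fin N`) for periodic boundary conditions,
and the exterior value is zero for compactly supported ones. -/
def outerL (bc : BoundaryCondition) (a b : ℝ) {N : ℕ} [NeZero N] (w : Fin N → ℝ[X])
    (i : Fin N) : ℝ :=
  match bc with
  | .periodic => innerR a b w (i - 1)
  | .compactSupport => if (i : ℕ) = 0 then 0 else innerR a b w (i - 1)

/-- `w⁺` at the right end of cell `i`: the limit from the neighbouring cell on the right. -/
def outerR (bc : BoundaryCondition) (a b : ℝ) {N : ℕ} [NeZero N] (w : Fin N → ℝ[X])
    (i : Fin N) : ℝ :=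
  match bc with
  | .periodic => innerL a b w (i + 1)
  | .compactSupport => if (i : ℕ) + 1 = N then 0 else innerL a b w (i + 1)

/-! ### Numerical fluxes, as functions of the two one-sided values -/

/-- Central part of the flux. -/
def fluxC (L : EntropyLaw) (um up : ℝ) : ℝ := (L.f up + L.f um) / 2

/-- Local wave speed: the maximum of `|f'|` on the interval between the two values. -/
def waveSpeed (L : EntropyLaw) (um up : ℝ) : ℝ :=
  sSup ((fun s => |deriv L.f s|) '' Set.uIcc um up)

/-- Diffusive part of the local Lax-Friedrichs flux. -/
def fluxD (L : EntropyLaw) (um up : ℝ) : ℝ := -(waveSpeed L um up * (up - um)) / 2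

/-- The local Lax-Friedrichs flux. -/
def flux (L : EntropyLaw) (um up : ℝ) : ℝ := fluxC L um up + fluxD L um up

/-- The central entropy flux. -/
def entropyFlux (L : EntropyLaw) (um up : ℝ) : ℝ := (L.F up + L.F um) / 2

/-! ### The artificial viscosity -/

/-- The weight `ν_i(x) = 1 - X_i(x)²`, `X_i(x) = (x - x_i)/(h/2)`. -/
def nu (a b : ℝ) {N : ℕ} (i : Fin N) (x : ℝ) : ℝ :=
  1 - ((x - xC a b i) / (meshSize a b N / 2)) ^ 2

/-- The Gauss-Lobatto points on the reference cell `[-1,1]`: the roots of `(X² - 1) P_k'(X)`, where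
`P_k` is the Legendre polynomial, a multiple of the `k`-th derivative of `(X² - 1)^k`. For
`k ≥ 1` these are `k + 1` points, among them `±1`. For `k = 0` there are none; then
the viscous term of the scheme vanishes whatever `v_h` is. -/
def gaussLobatto (k : ℕ) : Finset ℝ :=
  ((Polynomial.X ^ 2 - 1 : ℝ[X]) *
    Polynomial.derivative^[k + 1] ((Polynomial.X ^ 2 - 1 : ℝ[X]) ^ k)).roots.toFinset

/-- A point of the reference cell `[-1,1]` mapped to cell `i`. -/
def refMap (a b : ℝ) {N : ℕ} (i : Fin N) (ξ : ℝ) : ℝ := xC a b i + meshSize a b N / 2 * ξ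

/-- `v_h`: the polynomial on each cell interpolating the entropy variable `v(u_h) = U'(u_h)` at
the Gauss-Lobatto points. -/
def entropyVar (L : EntropyLaw) (k : ℕ) (a b : ℝ) {N : ℕ} (w : Fin N → ℝ[X]) :
    Fin N → ℝ[X] := fun i =>
  Lagrange.interpolate (gaussLobatto k) (refMap a b i)
    (fun ξ => deriv L.U ((w i).eval (refMap a b i ξ)))

/-- `A(u) = U''(u)⁻¹`. -/
def coeffA (L : EntropyLaw) (s : ℝ) : ℝ := (deriv (deriv L.U) s)⁻¹

/-- `‖[[∂_x^l w]]‖_{∂K_i}`: the sum of the absolute jumps of `∂_x^l w` at both ends of the cell. -/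
def jumpNorm (bc : BoundaryCondition) (a b : ℝ) {N : ℕ} [NeZero N] (w : Fin N → ℝ[X]) (l : ℕ)
    (i : Fin N) : ℝ :=
  let dw : Fin N → ℝ[X] := fun j => Polynomial.derivative^[l] (w j)
  |innerL a b dw i - outerL bc a b dw i| + |outerR bc a b dw i - innerR a b dw i|

/-- `σ_i^jump`, with `c_f = c₀ max_{K_i} |f'(u_h)|`. -/
def sigmaJump (L : EntropyLaw) (bc : BoundaryCondition) (k : ℕ) (c₀ a b : ℝ) {N : ℕ} [NeZero N]
    (w : Fin N → ℝ[X]) (i : Fin N) : ℝ :=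
  (c₀ * sSup ((fun x => |deriv L.f ((w i).eval x)|) '' Set.Icc (xL a b i) (xR a b i))) *
    (meshSize a b N * jumpNorm bc a b w 0 i +
      ∑ l ∈ Finset.Icc 1 k,
        (l : ℝ) * (l + 1) * meshSize a b N ^ (l + 1) * jumpNorm bc a b w l i)

/-- `E_i = ∫_{K_i} ν_i (v_h)_x A(u_h) (v_h)_x dx`. -/
def entropyE (L : EntropyLaw) (k : ℕ) (a b : ℝ) {N : ℕ} (w : Fin N → ℝ[X]) (i : Fin N) : ℝ :=
  ∫ x in (xL a b i)..(xR a b i),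
    nu a b i x * (entropyVar L k a b w i).derivative.eval x * coeffA L ((w i).eval x) *
      (entropyVar L k a b w i).derivative.eval x

/-- `F_i`, the entropy production of the central part of the scheme in cell `i`. -/
def entropyF (L : EntropyLaw) (bc : BoundaryCondition) (k : ℕ) (a b : ℝ) {N : ℕ} [NeZero N]
    (w : Fin N → ℝ[X]) (i : Fin N) : ℝ :=
  entropyFlux L (innerR a b w i) (outerR bc a b w i)
    - entropyFlux L (outerL bc a b w i) (innerL a b w i)
    - fluxC L (innerR a b w i) (outerR bc a b w i) * innerR a b (entropyVar L k a b w) i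
    + fluxC L (outerL bc a b w i) (innerL a b w i) * innerL a b (entropyVar L k a b w) i
    + ∫ x in (xL a b i)..(xR a b i),
        L.f ((w i).eval x) * (entropyVar L k a b w i).derivative.eval x

/-- `σ_i^entropy = min {max {F_i/E_i, 0}, C σ_i^jump}`. If `E_i = 0`, the quotient is read as `0`;
for the square entropy `u_h` is then constant in the cell and the viscous term is zero anyway. -/
def sigmaEntropy (L : EntropyLaw) (bc : BoundaryCondition) (k : ℕ) (C c₀ a b : ℝ) {N : ℕ}
    [NeZero N] (w : Fin N → ℝ[X]) (i : Fin N) : ℝ :=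
  min (max (entropyF L bc k a b w i / entropyE L k a b w i) 0)
    (C * sigmaJump L bc k c₀ a b w i)

/-- The viscosity parameter `σ_i = max {σ_i^jump, σ_i^entropy}`. -/
def sigma (L : EntropyLaw) (bc : BoundaryCondition) (k : ℕ) (C c₀ a b : ℝ) {N : ℕ}
    [NeZero N] (w : Fin N → ℝ[X]) (i : Fin N) : ℝ :=
  max (sigmaJump L bc k c₀ a b w i) (sigmaEntropy L bc k C c₀ a b w i)

/-! ### The scheme -/

/-- Right-hand side of the semi-discrete NOES-DG scheme in cell `i`, for the state `w` and the
test function `φ`. -/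
def schemeRHS (L : EntropyLaw) (bc : BoundaryCondition) (k : ℕ) (C c₀ a b : ℝ) {N : ℕ}
    [NeZero N] (w : Fin N → ℝ[X]) (i : Fin N) (φ : ℝ[X]) : ℝ :=
  (∫ x in (xL a b i)..(xR a b i), L.f ((w i).eval x) * φ.derivative.eval x)
    - flux L (innerR a b w i) (outerR bc a b w i) * φ.eval (xR a b i)
    + flux L (outerL bc a b w i) (innerL a b w i) * φ.eval (xL a b i)
    - sigma L bc k C c₀ a b w i *
      ∫ x in (xL a b i)..(xR a b i),
        nu a b i x * (entropyVar L k a b w i).derivative.eval x * coeffA L ((w i).eval x) *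
          φ.derivative.eval x

/-- `uh : [0,T] → V_h^k` is a solution of the semi-discrete NOES-DG scheme whose initial value is
the `L²` projection of `u₀`. -/
structure IsSolution (L : EntropyLaw) (bc : BoundaryCondition) (k : ℕ) (C c₀ a b T : ℝ) {N : ℕ}
    [NeZero N] (u₀ : ℝ → ℝ) (uh : ℝ → Fin N → ℝ[X]) : Prop where
  mem : ∀ t ∈ Set.Icc 0 T, uh t ∈ DGSpace N k
  differentiable : ∀ (i : Fin N) (n : ℕ),
    DifferentiableOn ℝ (fun t => (uh t i).coeff n) (Set.Icc 0 T)
  initial : ∀ (i : Fin N) (φ : ℝ[X]), φ.natDegree ≤ k →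
    ∫ x in (xL a b i)..(xR a b i), (uh 0 i).eval x * φ.eval x =
      ∫ x in (xL a b i)..(xR a b i), u₀ x * φ.eval x
  scheme : ∀ t ∈ Set.Icc 0 T, ∀ (i : Fin N) (φ : ℝ[X]), φ.natDegree ≤ k →
    ∫ x in (xL a b i)..(xR a b i),
        derivWithin (fun s => (uh s i).eval x) (Set.Icc 0 T) t * φ.eval x =
      schemeRHS L bc k C c₀ a b (uh t) i φ

/-- `‖g - w‖_{L²(Ω)}` for a function `g` and a piecewise polynomial `w`. -/
def l2Error (a b : ℝ) {N : ℕ} (g : ℝ → ℝ) (w : Fin N → ℝ[X]) : ℝ :=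
  Real.sqrt (∑ i : Fin N, ∫ x in (xL a b i)..(xR a b i), (g x - (w i).eval x) ^ 2)

end

end NOESDG

namespace NOESDG

open Polynomial

/-! ### Gauss-Lobatto points -/

/-! For `f(u) = u` the Lax-Friedrichs flux is the upwind flux, and interpolation of `v(u_h) = u_h`
at the Gauss-Lobatto points reproduces `u_h`. The scheme is thus upwind DG plus the viscosity `σ_i ∫
ν_i (u_h)_x w_x`, whose coefficient depends on the solution.

Let `P` be the Gauss-Radau projection that keeps the moments of degree below `k` and the value at
the right end of each cell. Write `u - u_h = (u - Pu) + ξ` with `ξ = Pu - u_h`. The first part is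
`O(h^{k+1})`. Testing the error equation with `ξ`, the convective terms do not see `u - Pu`: the
volume term pairs it with `ξ_x`, of degree below `k`, and the upwind flux evaluates it where it
vanishes. What remains is a source `(Pu_t - u_t, ξ)` of size `h^{k+1}‖ξ‖`, interface terms that
cancel around the cyclic mesh up to a dissipative square, and the viscosity (`cell_energy`).

About `σ` only `0 ≤ σ ≤ C σ^jump` is needed; the quotient `F_i/E_i` plays no role. Substituting `u_h
= Pu - ξ`, the viscosity gives `-σ ∫ ν ξ_x²`, which has the good sign and is dropped, and `σ ∫ ν
(Pu)_x ξ_x`. As `u` and its derivatives have no jumps, the jumps of `u_h` are jumps of the error. An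
inverse inequality then bounds `σ/h` linearly by `‖ξ‖ + h^{k+1}` on the cell and its neighbours
(`sigma_div_le`). Since `(Pu)_x` is bounded by the exact solution alone, this term too is quadratic
in the error, and no a priori bound on `u_h` is required.

In reference variables the energy `E = ∑ ‖ξ_i‖²` therefore satisfies `E' ≤ K (E + N h^{2k+2})`
(`exists_energy_rate`). Grönwall's inequality, an initial error of the same order, and `N h = b - a`
finish the proof. Time derivatives of `Pu` are explicit because `u(x,t) = u(x - t, 0)`. -/

/-- Repeated differentiation of `(X² - 1) p' = 2k X p` for `p = (X² - 1)^k`. At `j = k - 1` the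
middle term disappears, which links the Gauss-Lobatto polynomial to a lower derivative of `p`. -/
theorem mul_iterate_derivative_rodrigues (k j : ℕ) :
    ∃ c : ℝ, (j + 1 ≤ k → 0 < c) ∧
      ((X : ℝ[X]) ^ 2 - 1) * derivative^[j + 2] (((X : ℝ[X]) ^ 2 - 1) ^ k) =
        C (2 * ((k : ℝ) - j - 1)) * X * derivative^[j + 1] (((X : ℝ[X]) ^ 2 - 1) ^ k) +
          C c * derivative^[j] (((X : ℝ[X]) ^ 2 - 1) ^ k) := by
  have base : ((X : ℝ[X]) ^ 2 - 1) * derivative (((X : ℝ[X]) ^ 2 - 1) ^ k) =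
      C (2 * (k : ℝ)) * X * ((X : ℝ[X]) ^ 2 - 1) ^ k := by
    rcases k with _ | k
    · simp
    · rw [derivative_pow]
      simp only [derivative_sub, derivative_one, derivative_X_pow, Nat.add_sub_cancel, C_mul]
      have : (C (2 : ℝ) : ℝ[X]) = 2 := rfl
      simp only [this, map_natCast]
      push_cast
      ring
  induction j with
  | zero =>
    refine ⟨2 * k, fun h => by have : 0 < k := by omega
                               positivity, ?_⟩
    have h := congrArg derivative base
    simp only [derivative_mul, derivative_sub, derivative_one, derivative_X_pow, derivative_C,
      derivative_X] at h
    simp only [Function.iterate_succ, Function.iterate_zero, Function.comp, id]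
    have e : (C (2 * ((k : ℝ) - (0 : ℕ) - 1)) : ℝ[X]) = C (2 * (k : ℝ)) - 2 := by
      have : (2 : ℝ[X]) = C 2 := rfl
      rw [this, ← C_sub]; congr 1; push_cast; ring
    have e2 : (C (((2 : ℕ) : ℝ)) : ℝ[X]) = 2 := rfl
    rw [e]
    rw [e2] at h
    linear_combination h
  | succ j ih =>
    obtain ⟨c, hc, h⟩ := ih
    refine ⟨c + 2 * ((k : ℝ) - j - 1), fun hj => ?_, ?_⟩
    · have h1 := hc (by omega)
      have : (j : ℝ) + 1 + 1 ≤ k := by exact_mod_cast hj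
      linarith
    · have h := congrArg derivative h
      simp only [derivative_mul, derivative_add, derivative_sub, derivative_one, derivative_X_pow,
        derivative_C, derivative_X, ← Function.iterate_succ_apply' derivative] at h
      have e : (C (2 * ((k : ℝ) - (j + 1 : ℕ) - 1)) : ℝ[X]) = C (2 * ((k : ℝ) - j - 1)) - 2 := by
        have : (2 : ℝ[X]) = C 2 := rfl
        rw [this, ← C_sub]; congr 1; push_cast; ring
      have e2 : (C (((2 : ℕ) : ℝ)) : ℝ[X]) = 2 := rfl
      rw [e, C_add]
      rw [e2] at h
      simp only [Nat.succ_eq_add_one] at h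
      linear_combination h

theorem iterate_derivative_rodrigues_ne_zero (k j : ℕ) (hj : j ≤ k) :
    derivative^[j] (((X : ℝ[X]) ^ 2 - 1) ^ k) ≠ 0 := by
  intro h
  have hm : (((X : ℝ[X]) ^ 2 - 1) ^ k).Monic := (monic_X_pow_sub_C (1 : ℝ) two_ne_zero).pow k
  have hd : (((X : ℝ[X]) ^ 2 - 1) ^ k).natDegree = 2 * k := by
    have : ((X : ℝ[X]) ^ 2 - 1).natDegree = 2 := natDegree_X_pow_sub_C (r := (1 : ℝ))
    rw [natDegree_pow, this, mul_comm]
  have hc := congrArg (fun q => q.coeff (2 * k - j)) h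
  simp only [coeff_iterate_derivative, coeff_zero] at hc
  rw [Nat.sub_add_cancel (by omega)] at hc
  have : (((X : ℝ[X]) ^ 2 - 1) ^ k).coeff (2 * k) = 1 := by
    rw [← hd]; exact hm
  rw [this, nsmul_eq_mul, mul_one, Nat.cast_eq_zero, Nat.descFactorial_eq_zero_iff_lt] at hc
  omega

/-- Rolle: each differentiation yields a new root between consecutive old ones, and `±1` remain
roots because their multiplicity is `k > j`. -/
theorem add_two_le_card_roots_rodrigues (k j : ℕ) (hj : j < k) :
    j + 2 ≤ (derivative^[j] (((X : ℝ[X]) ^ 2 - 1) ^ k)).roots.toFinset.card := by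
  have key : ∀ j < k, ({1, -1} : Finset ℝ) ⊆
      (derivative^[j] (((X : ℝ[X]) ^ 2 - 1) ^ k)).roots.toFinset := by
    intro j hj x hx
    rw [Multiset.mem_toFinset, mem_roots (iterate_derivative_rodrigues_ne_zero k j hj.le)]
    obtain ⟨q, hq⟩ := pow_sub_dvd_iterate_derivative_pow ((X : ℝ[X]) ^ 2 - 1) k j
    rw [IsRoot, hq, eval_mul, eval_pow]
    have : eval x ((X : ℝ[X]) ^ 2 - 1) = 0 := by
      simp only [Finset.mem_insert, Finset.mem_singleton] at hx
      rcases hx with rfl | rfl <;> simp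
    rw [this, zero_pow (by omega), zero_mul]
  have hcard : ({1, -1} : Finset ℝ).card = 2 := Finset.card_pair (by norm_num)
  induction j with
  | zero => simpa [hcard] using Finset.card_le_card (key 0 hj)
  | succ j ih =>
    have h1 := ih (by omega)
    have h2 := card_roots_toFinset_le_card_roots_derivative_sdiff_roots_succ
      (derivative^[j] (((X : ℝ[X]) ^ 2 - 1) ^ k))
    rw [← Function.iterate_succ_apply' derivative] at h2
    -- The Rolle roots are not roots of the previous derivative, while `±1` are; so the two counts
    -- add up.
    have hdisj : Disjoint ((derivative^[j + 1] (((X : ℝ[X]) ^ 2 - 1) ^ k)).roots.toFinset \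
        (derivative^[j] (((X : ℝ[X]) ^ 2 - 1) ^ k)).roots.toFinset) ({1, -1} : Finset ℝ) :=
      Finset.disjoint_of_subset_right (key j (by omega)) Finset.sdiff_disjoint
    have h3 := Finset.card_le_card (Finset.union_subset (Finset.sdiff_subset
      (t := (derivative^[j] (((X : ℝ[X]) ^ 2 - 1) ^ k)).roots.toFinset)) (key (j + 1) hj))
    rw [Finset.card_union_of_disjoint hdisj, hcard] at h3
    simp only [Nat.succ_eq_add_one] at h2
    omega

theorem succ_le_card_gaussLobatto (k : ℕ) (hk : 1 ≤ k) : k + 1 ≤ (gaussLobatto k).card := by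
  obtain ⟨j, rfl⟩ : ∃ j, k = j + 1 := ⟨k - 1, by omega⟩
  obtain ⟨c, hc, h⟩ := mul_iterate_derivative_rodrigues (j + 1) j
  have h' : ((X : ℝ[X]) ^ 2 - 1) * derivative^[j + 1 + 1] (((X : ℝ[X]) ^ 2 - 1) ^ (j + 1)) =
      C c * derivative^[j] (((X : ℝ[X]) ^ 2 - 1) ^ (j + 1)) := by
    rw [h]; push_cast; simp
  rw [gaussLobatto, h', roots_C_mul _ (hc le_rfl).ne']
  exact add_two_le_card_roots_rodrigues (j + 1) j (by omega)

/-- Here `v` is the identity, and interpolation at more than `k` nodes reproduces a polynomial of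
degree at most `k`. For `k = 0` there are no nodes, but both derivatives vanish. -/
theorem derivative_entropyVar {a b : ℝ} {N k : ℕ} (hh : meshSize a b N ≠ 0)
    (w : Fin N → ℝ[X]) (i : Fin N) (hw : (w i).natDegree ≤ k) :
    derivative (entropyVar linearSquare k a b w i) = derivative (w i) := by
  have hU : deriv linearSquare.U = fun s => s := by
    funext s
    simp [linearSquare]
  rcases Nat.eq_zero_or_pos k with rfl | hk
  · have h0 : gaussLobatto 0 = ∅ := by simp [gaussLobatto]
    rw [derivative_of_natDegree_zero (p := w i) (by omega), entropyVar, h0]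
    simp
  · congr 1
    symm
    have hinj : Set.InjOn (refMap a b i) (gaussLobatto k : Set ℝ) := by
      intro x _ y _ hxy
      simpa [refMap, hh] using hxy
    rw [entropyVar, hU]
    apply Lagrange.eq_interpolate hinj
    calc (w i).degree ≤ (k : ℕ) := natDegree_le_iff_degree_le.mp hw
      _ < ((gaussLobatto k).card : WithBot ℕ) := by
        exact_mod_cast Nat.lt_of_succ_le (succ_le_card_gaussLobatto k hk)

/-! ### The reference cell `[0,1]` -/

theorem integral_mul_sq_le {f g : ℝ → ℝ} (hf : Continuous f) (hg : Continuous g) :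
    (∫ x in (0 : ℝ)..1, f x * g x) ^ 2 ≤
      (∫ x in (0 : ℝ)..1, f x ^ 2) * ∫ x in (0 : ℝ)..1, g x ^ 2 := by
  have key : ∀ r : ℝ, 0 ≤ (∫ x in (0 : ℝ)..1, g x ^ 2) * (r * r) +
      (2 * ∫ x in (0 : ℝ)..1, f x * g x) * r + ∫ x in (0 : ℝ)..1, f x ^ 2 := by
    intro r
    have h : 0 ≤ ∫ x in (0 : ℝ)..1, (f x + r * g x) ^ 2 :=
      intervalIntegral.integral_nonneg zero_le_one fun x _ => sq_nonneg _
    have e : (fun x => (f x + r * g x) ^ 2) =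
        fun x => f x ^ 2 + ((2 * r) * (f x * g x) + (r * r) * g x ^ 2) := by
      funext x; ring
    have hc1 : Continuous fun x => f x ^ 2 := by fun_prop
    have hc2 : Continuous fun x => (2 * r) * (f x * g x) := by fun_prop
    have hc3 : Continuous fun x => (r * r) * g x ^ 2 := by fun_prop
    rw [e, intervalIntegral.integral_add (hc1.intervalIntegrable _ _)
      ((hc2.fun_add hc3).intervalIntegrable _ _), intervalIntegral.integral_add
      (hc2.intervalIntegrable _ _) (hc3.intervalIntegrable _ _),
      intervalIntegral.integral_const_mul, intervalIntegral.integral_const_mul] at h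
    linarith
  have := discrim_le_zero key
  rw [discrim] at this
  nlinarith

theorem abs_integral_mul_le {f g : ℝ → ℝ} (hf : Continuous f) (hg : Continuous g) {B : ℝ}
    (hB : ∀ x ∈ Set.Icc (0 : ℝ) 1, |f x| ≤ B) :
    |∫ x in (0 : ℝ)..1, f x * g x| ≤ B * Real.sqrt (∫ x in (0 : ℝ)..1, g x ^ 2) := by
  have hB0 : 0 ≤ B := (abs_nonneg _).trans (hB 0 (by simp))
  have hg0 : 0 ≤ ∫ x in (0 : ℝ)..1, g x ^ 2 :=
    intervalIntegral.integral_nonneg zero_le_one fun x _ => sq_nonneg _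
  have hf2 : ∫ x in (0 : ℝ)..1, f x ^ 2 ≤ B ^ 2 := by
    have : ∫ x in (0 : ℝ)..1, f x ^ 2 ≤ ∫ x in (0 : ℝ)..1, B ^ 2 := by
      apply intervalIntegral.integral_mono_on zero_le_one
      · exact (hf.pow 2).intervalIntegrable _ _
      · exact continuous_const.intervalIntegrable _ _
      · intro x hx
        rw [← sq_abs]
        exact pow_le_pow_left₀ (abs_nonneg _) (hB x hx) 2
    simpa using this
  apply abs_le_of_sq_le_sq _ (by positivity)
  rw [mul_pow, Real.sq_sqrt hg0]
  exact (integral_mul_sq_le hf hg).trans (mul_le_mul_of_nonneg_right hf2 hg0)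

/-- The weight may vanish at the end points, as `1 - x` does in the uniqueness proof for the
Gauss-Radau projection. -/
theorem eq_zero_of_integral_weight_mul_sq {w : ℝ → ℝ} (hw : Continuous w)
    (hpos : ∀ x ∈ Set.Ioo (0 : ℝ) 1, 0 < w x) {p : ℝ[X]}
    (h : ∫ x in (0 : ℝ)..1, w x * p.eval x ^ 2 = 0) : p = 0 := by
  by_contra hp
  have hc : Continuous fun x => w x * p.eval x ^ 2 := by fun_prop
  have hinf : (Set.Ioo (0 : ℝ) 1).Infinite := Set.Ioo_infinite zero_lt_one
  obtain ⟨x, hx, hxr⟩ := hinf.exists_notMem_finset p.roots.toFinset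
  have hx0 : p.eval x ≠ 0 := by
    intro h0
    exact hxr (by rw [Multiset.mem_toFinset, mem_roots hp]; exact h0)
  have hw0 : ∀ y ∈ Set.Icc (0 : ℝ) 1, 0 ≤ w y := by
    intro y hy
    have : y ∈ closure (Set.Ioo (0 : ℝ) 1) := by rwa [closure_Ioo zero_ne_one]
    exact closure_minimal (fun z hz => (hpos z hz).le : Set.Ioo (0 : ℝ) 1 ⊆ {z | 0 ≤ w z})
      (isClosed_le continuous_const hw) this
  have : 0 < ∫ x in (0 : ℝ)..1, w x * p.eval x ^ 2 := by
    apply intervalIntegral.integral_pos zero_lt_one hc.continuousOn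
    · intro y hy
      exact mul_nonneg (hw0 y ⟨hy.1.le, hy.2⟩) (sq_nonneg _)
    · exact ⟨x, ⟨hx.1.le, hx.2.le⟩, mul_pos (hpos x hx) (by positivity)⟩
  exact this.ne' h

/-- The `L²(0,1)` pairing of polynomials, as a linear functional of the second argument. -/
noncomputable def pairing (p : ℝ[X]) : ℝ[X] →ₗ[ℝ] ℝ where
  toFun q := ∫ x in (0 : ℝ)..1, p.eval x * q.eval x
  map_add' q r := by
    rw [← intervalIntegral.integral_add]
    · simp [mul_add]
    · exact Continuous.intervalIntegrable (by fun_prop) _ _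
    · exact Continuous.intervalIntegrable (by fun_prop) _ _
  map_smul' c q := by
    rw [RingHom.id_apply, smul_eq_mul, ← intervalIntegral.integral_const_mul]
    congr 1; funext x; simp; ring

theorem pairing_apply (p q : ℝ[X]) :
    pairing p q = ∫ x in (0 : ℝ)..1, p.eval x * q.eval x := rfl

theorem pairing_comm (p q : ℝ[X]) : pairing p q = pairing q p := by
  simp only [pairing_apply, mul_comm]

theorem eq_zero_of_pairing_self {p : ℝ[X]} (h : pairing p p = 0) : p = 0 := by
  apply eq_zero_of_integral_weight_mul_sq (w := fun _ => 1) continuous_const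
    (fun _ _ => zero_lt_one)
  rw [← h, pairing_apply]
  congr 1; funext x; ring

instance (n : ℕ) : FiniteDimensional ℝ (degreeLT ℝ n) :=
  Module.Finite.equiv (degreeLTEquiv ℝ n).symm

theorem finrank_degreeLT (n : ℕ) : Module.finrank ℝ (degreeLT ℝ n) = n := by
  rw [(degreeLTEquiv ℝ n).finrank_eq]; simp

theorem mem_degreeLT_succ_iff {p : ℝ[X]} {k : ℕ} :
    p ∈ degreeLT ℝ (k + 1) ↔ p.natDegree ≤ k := by
  rw [mem_degreeLT, degree_lt_iff_coeff_zero, natDegree_le_iff_coeff_eq_zero]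
  rfl

/-- Riesz representation on the polynomials of degree at most `k`. -/
theorem exists_pairing_eq (k : ℕ) (l : ℝ[X] →ₗ[ℝ] ℝ) :
    ∃ r : ℝ[X], ∀ q : ℝ[X], q.natDegree ≤ k → l q = pairing r q := by
  let Φ : degreeLT ℝ (k + 1) →ₗ[ℝ] Module.Dual ℝ (degreeLT ℝ (k + 1)) :=
    LinearMap.mk₂ ℝ (fun p q => pairing p.1 q.1)
      (fun p p' q => by simp only [pairing_comm _ q.1]; simp)
      (fun c p q => by simp only [pairing_comm _ q.1]; simp)
      (fun p q q' => by simp) (fun c p q => by simp)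
  have hinj : Function.Injective Φ := by
    rw [← LinearMap.ker_eq_bot, LinearMap.ker_eq_bot']
    intro p hp
    have : pairing p.1 p.1 = 0 := LinearMap.congr_fun hp p
    exact Subtype.ext (eq_zero_of_pairing_self this)
  have hsurj : Function.Surjective Φ :=
    (LinearMap.injective_iff_surjective_of_finrank_eq_finrank
      (Subspace.dual_finrank_eq).symm).mp hinj
  obtain ⟨r, hr⟩ := hsurj (l.comp (degreeLT ℝ (k + 1)).subtype)
  refine ⟨r.1, fun q hq => ?_⟩
  exact (LinearMap.congr_fun hr ⟨q, mem_degreeLT_succ_iff.mpr hq⟩).symm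

theorem exists_abs_iterate_derivative_le (k : ℕ) (p : ℝ[X]) :
    ∃ K : ℝ, 0 ≤ K ∧ ∀ l ≤ k, ∀ s ∈ Set.Icc (0 : ℝ) 1, |(derivative^[l] p).eval s| ≤ K := by
  have h : ∀ l, ∃ K : ℝ, ∀ s ∈ Set.Icc (0 : ℝ) 1, |(derivative^[l] p).eval s| ≤ K := fun l =>
    isCompact_Icc.exists_bound_of_continuousOn (derivative^[l] p).continuous.continuousOn
  choose K hK using h
  have hK0 : ∀ l, 0 ≤ K l := fun l => (abs_nonneg _).trans (hK l 0 (by simp))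
  refine ⟨∑ l ∈ Finset.range (k + 1), K l, Finset.sum_nonneg fun l _ => hK0 l,
    fun l hl s hs => (hK l s hs).trans ?_⟩
  exact Finset.single_le_sum (fun l _ => hK0 l) (Finset.mem_range.mpr (by omega))

/-- Inverse inequality on the reference cell. -/
theorem exists_inverse_inequality (k : ℕ) :
    ∃ K : ℝ, 0 ≤ K ∧ ∀ q : ℝ[X], q.natDegree ≤ k → ∀ l ≤ k, ∀ s ∈ Set.Icc (0 : ℝ) 1,
      |(derivative^[l] q).eval s| ≤ K * Real.sqrt (∫ x in (0 : ℝ)..1, q.eval x ^ 2) := by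
  -- Each coefficient is the `L²` pairing with a fixed polynomial `r n`, hence bounded by the `L²`
  -- norm; derivatives are then bounded coefficient by coefficient.
  choose r hr using fun n => exists_pairing_eq k (lcoeff ℝ n)
  choose D hD0 hD using fun n => exists_abs_iterate_derivative_le k ((X : ℝ[X]) ^ n)
  choose M hM0 hM using fun n => exists_abs_iterate_derivative_le k (r n)
  refine ⟨∑ n ∈ Finset.range (k + 1), M n * D n,
    Finset.sum_nonneg fun n _ => mul_nonneg (hM0 n) (hD0 n), fun q hq l hl s hs => ?_⟩
  have hq' : q = ∑ n ∈ Finset.range (k + 1), C (q.coeff n) * X ^ n :=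
    q.as_sum_range_C_mul_X_pow' (by omega)
  have e : (derivative^[l] q).eval s =
      ∑ n ∈ Finset.range (k + 1), q.coeff n * (derivative^[l] ((X : ℝ[X]) ^ n)).eval s := by
    conv_lhs => rw [hq']
    rw [iterate_derivative_sum, eval_finsetSum]
    refine Finset.sum_congr rfl fun n _ => ?_
    rw [iterate_derivative_C_mul, eval_mul, eval_C]
  rw [e, Finset.sum_mul]
  refine (Finset.abs_sum_le_sum_abs _ _).trans (Finset.sum_le_sum fun n _ => ?_)
  rw [abs_mul]
  have h1 : |q.coeff n| ≤ M n * Real.sqrt (∫ x in (0 : ℝ)..1, q.eval x ^ 2) := by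
    have := hr n q hq
    rw [lcoeff_apply, pairing_apply] at this
    rw [this]
    exact abs_integral_mul_le (r n).continuous q.continuous fun x hx => hM n 0 (Nat.zero_le _) x hx
  calc _ ≤ (M n * Real.sqrt (∫ x in (0 : ℝ)..1, q.eval x ^ 2)) * D n :=
        mul_le_mul h1 (hD n l hl s hs) (abs_nonneg _) (by have := hM0 n; positivity)
    _ = _ := by ring

/-! ### The Gauss-Radau projection -/

/-- Write `p = (X - 1) q` with `deg q < k`. Orthogonality to `q` gives `∫ (1 - x) q² = 0`. -/
theorem eq_zero_of_radau {k : ℕ} {p : ℝ[X]} (hp : p.natDegree ≤ k)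
    (hm : ∀ j < k, ∫ x in (0 : ℝ)..1, x ^ j * p.eval x = 0) (h1 : p.eval 1 = 0) : p = 0 := by
  obtain ⟨q, rfl⟩ := dvd_iff_isRoot.mpr h1
  by_cases hq : q = 0
  · simp [hq]
  exfalso
  have hdeg : q.natDegree < k := by
    rw [natDegree_mul (X_sub_C_ne_zero 1) hq, natDegree_X_sub_C] at hp
    omega
  have h : pairing ((X - C 1) * q) q = 0 := by
    rw [q.as_sum_range_C_mul_X_pow' hdeg, map_sum]
    refine Finset.sum_eq_zero fun j hj => ?_
    rw [← q.as_sum_range_C_mul_X_pow' hdeg, ← smul_eq_C_mul, map_smul, pairing_comm, pairing_apply]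
    simp only [eval_pow, eval_X]
    rw [hm j (Finset.mem_range.mp hj), smul_zero]
  apply hq
  apply eq_zero_of_integral_weight_mul_sq (w := fun x => 1 - x) (by fun_prop)
    (fun x hx => sub_pos.mpr hx.2)
  rw [pairing_apply] at h
  rw [← neg_eq_zero, ← intervalIntegral.integral_neg, ← h]
  congr 1; funext x; simp; ring

/-- The `k` moments and the value at `1` are `k + 1` functionals, jointly injective on a space of
dimension `k + 1`, so they have a dual basis. Through it the projection becomes an explicit formula,
linear in the data. -/
theorem exists_radau_basis (k : ℕ) : ∃ (A : Fin k → ℝ[X]) (B : ℝ[X]),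
    (∀ j, (A j).natDegree ≤ k) ∧ B.natDegree ≤ k ∧
    (∀ i j : Fin k, ∫ x in (0 : ℝ)..1, x ^ (i : ℕ) * (A j).eval x = if i = j then 1 else 0) ∧
    (∀ j, (A j).eval 1 = 0) ∧
    (∀ i : Fin k, ∫ x in (0 : ℝ)..1, x ^ (i : ℕ) * B.eval x = 0) ∧ B.eval 1 = 1 := by
  let Φ : degreeLT ℝ (k + 1) →ₗ[ℝ] (Fin k → ℝ) × ℝ :=
    ((LinearMap.pi fun i : Fin k => pairing (X ^ (i : ℕ))).prod (leval 1)).comp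
      (degreeLT ℝ (k + 1)).subtype
  have hΦ : ∀ p, Φ p = (fun i : Fin k => ∫ x in (0 : ℝ)..1, x ^ (i : ℕ) * p.1.eval x,
      p.1.eval 1) := by
    intro p
    apply Prod.ext
    · funext i
      change pairing (X ^ (i : ℕ)) p.1 = _
      simp [pairing_apply]
    · rfl
  have hinj : Function.Injective Φ := by
    rw [← LinearMap.ker_eq_bot, LinearMap.ker_eq_bot']
    intro p hp
    rw [hΦ] at hp
    refine Subtype.ext (eq_zero_of_radau (mem_degreeLT_succ_iff.mp p.2) (fun j hj => ?_)
      (congrArg Prod.snd hp))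
    exact congrFun (congrArg Prod.fst hp) ⟨j, hj⟩
  have hsurj : Function.Surjective Φ :=
    (LinearMap.injective_iff_surjective_of_finrank_eq_finrank
      (by rw [finrank_degreeLT]; simp)).mp hinj
  choose A hA using fun j : Fin k => hsurj (fun i => if i = j then 1 else 0, 0)
  obtain ⟨B, hB⟩ := hsurj (0, 1)
  refine ⟨fun j => (A j).1, B.1, fun j => mem_degreeLT_succ_iff.mp (A j).2,
    mem_degreeLT_succ_iff.mp B.2, fun i j => ?_, fun j => ?_, fun i => ?_, ?_⟩
  · have := congrFun (congrArg Prod.fst (hΦ (A j))) i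
    rw [hA] at this; exact this.symm
  · have := congrArg Prod.snd (hΦ (A j))
    rw [hA] at this; exact this.symm
  · have := congrFun (congrArg Prod.fst (hΦ B)) i
    rw [hB] at this; exact this.symm
  · have := congrArg Prod.snd (hΦ B)
    rw [hB] at this; exact this.symm

noncomputable def radauA (k : ℕ) : Fin k → ℝ[X] := (exists_radau_basis k).choose

noncomputable def radauB (k : ℕ) : ℝ[X] := (exists_radau_basis k).choose_spec.choose

theorem radau_basis_spec (k : ℕ) : (∀ j, (radauA k j).natDegree ≤ k) ∧ (radauB k).natDegree ≤ k ∧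
    (∀ i j : Fin k,
      ∫ x in (0 : ℝ)..1, x ^ (i : ℕ) * (radauA k j).eval x = if i = j then 1 else 0) ∧
    (∀ j, (radauA k j).eval 1 = 0) ∧
    (∀ i : Fin k, ∫ x in (0 : ℝ)..1, x ^ (i : ℕ) * (radauB k).eval x = 0) ∧
      (radauB k).eval 1 = 1 :=
  (exists_radau_basis k).choose_spec.choose_spec

/-- The Gauss-Radau projection on `[0,1]`: it preserves the moments against the polynomials of
degree less than `k` and the value at the right end point. -/
noncomputable def radau (k : ℕ) (g : ℝ → ℝ) : ℝ[X] :=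
  ∑ j : Fin k, C (∫ x in (0 : ℝ)..1, x ^ (j : ℕ) * g x) * radauA k j + C (g 1) * radauB k

theorem natDegree_radau_le (k : ℕ) (g : ℝ → ℝ) : (radau k g).natDegree ≤ k := by
  obtain ⟨hA, hB, -⟩ := radau_basis_spec k
  refine natDegree_add_le_of_degree_le (natDegree_sum_le_of_forall_le _ _ fun j _ => ?_) ?_
  · exact (natDegree_C_mul_le _ _).trans (hA j)
  · exact (natDegree_C_mul_le _ _).trans hB

theorem eval_one_radau (k : ℕ) (g : ℝ → ℝ) : (radau k g).eval 1 = g 1 := by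
  obtain ⟨-, -, -, hA, -, hB⟩ := radau_basis_spec k
  simp [radau, eval_finsetSum, hA, hB]

theorem pairing_X_pow (i : ℕ) (p : ℝ[X]) :
    pairing (X ^ i) p = ∫ x in (0 : ℝ)..1, x ^ i * p.eval x := by
  simp [pairing_apply]

theorem integral_pow_mul_radau (k : ℕ) (g : ℝ → ℝ) (i : ℕ) (hi : i < k) :
    ∫ x in (0 : ℝ)..1, x ^ i * (radau k g).eval x = ∫ x in (0 : ℝ)..1, x ^ i * g x := by
  obtain ⟨-, -, hA, -, hB, -⟩ := radau_basis_spec k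
  have hA' := fun j => hA ⟨i, hi⟩ j
  have hB' := hB ⟨i, hi⟩
  simp only [← pairing_X_pow] at hA' hB' ⊢
  rw [radau, map_add, map_sum]
  simp only [← smul_eq_C_mul, map_smul, hA', hB']
  simp

theorem integral_radau_mul (k : ℕ) {g : ℝ → ℝ} (hg : Continuous g) {q : ℝ[X]}
    (hq : q.natDegree < k) :
    ∫ x in (0 : ℝ)..1, (radau k g).eval x * q.eval x = ∫ x in (0 : ℝ)..1, g x * q.eval x := by
  have key : ∀ f : ℝ → ℝ, Continuous f → ∫ x in (0 : ℝ)..1, f x * q.eval x =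
      ∑ i ∈ Finset.range k, q.coeff i * ∫ x in (0 : ℝ)..1, x ^ i * f x := by
    intro f hf
    simp only [← intervalIntegral.integral_const_mul]
    rw [← intervalIntegral.integral_finsetSum]
    · congr 1; funext x
      rw [eval_eq_sum_range' hq, Finset.mul_sum]
      refine Finset.sum_congr rfl fun i _ => by ring
    · intro i _
      exact Continuous.intervalIntegrable (by fun_prop) _ _
  rw [key _ (radau k g).continuous, key _ hg]
  refine Finset.sum_congr rfl fun i hi => ?_
  rw [integral_pow_mul_radau k g i (Finset.mem_range.mp hi)]

theorem radau_eval (k : ℕ) {q : ℝ[X]} (hq : q.natDegree ≤ k) :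
    radau k (fun x => q.eval x) = q := by
  rw [← sub_eq_zero]
  refine eq_zero_of_radau (k := k) ?_ (fun j hj => ?_) ?_
  · simpa using natDegree_sub_le_of_le (natDegree_radau_le k fun x => q.eval x) hq
  · rw [← pairing_X_pow, map_sub, pairing_X_pow, pairing_X_pow, integral_pow_mul_radau k _ j hj,
      sub_self]
  · rw [eval_sub, eval_one_radau, sub_self]

theorem radau_sub (k : ℕ) {f g : ℝ → ℝ} (hf : Continuous f) (hg : Continuous g) :
    radau k (fun x => f x - g x) = radau k f - radau k g := by
  have : ∀ j : ℕ, ∫ x in (0 : ℝ)..1, x ^ j * (f x - g x) =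
      (∫ x in (0 : ℝ)..1, x ^ j * f x) - ∫ x in (0 : ℝ)..1, x ^ j * g x := by
    intro j
    rw [← intervalIntegral.integral_sub]
    · simp only [mul_sub]
    · exact Continuous.intervalIntegrable (by fun_prop) _ _
    · exact Continuous.intervalIntegrable (by fun_prop) _ _
  simp only [radau, this, C_sub, sub_mul, Finset.sum_sub_distrib]
  ring

/-- Stability in the sup norm: the dual basis is fixed and the functionals are bounded by `sup |g|`.
-/
theorem exists_abs_radau_le (k : ℕ) : ∃ K : ℝ, 0 ≤ K ∧ ∀ g : ℝ → ℝ, Continuous g → ∀ B : ℝ,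
    (∀ s ∈ Set.Icc (0 : ℝ) 1, |g s| ≤ B) → ∀ l ≤ k, ∀ s ∈ Set.Icc (0 : ℝ) 1,
      |(derivative^[l] (radau k g)).eval s| ≤ K * B := by
  choose KA hA0 hA using fun j => exists_abs_iterate_derivative_le k (radauA k j)
  obtain ⟨KB, hB0, hKB⟩ := exists_abs_iterate_derivative_le k (radauB k)
  refine ⟨∑ j, KA j + KB, add_nonneg (Finset.sum_nonneg fun j _ => hA0 j) hB0,
    fun g hg B hB l hl s hs => ?_⟩
  have hBn : 0 ≤ B := (abs_nonneg _).trans (hB 0 (by simp))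
  have e : (derivative^[l] (radau k g)).eval s =
      ∑ j : Fin k, (∫ x in (0 : ℝ)..1, x ^ (j : ℕ) * g x) * (derivative^[l] (radauA k j)).eval s +
        g 1 * (derivative^[l] (radauB k)).eval s := by
    rw [radau, iterate_map_add, iterate_derivative_sum, eval_add, eval_finsetSum,
      iterate_derivative_C_mul, eval_mul, eval_C]
    congr 1
    refine Finset.sum_congr rfl fun j _ => ?_
    rw [iterate_derivative_C_mul, eval_mul, eval_C]
  have hm : ∀ j : ℕ, |∫ x in (0 : ℝ)..1, x ^ j * g x| ≤ B := by
    intro j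
    have := intervalIntegral.norm_integral_le_of_norm_le_const (a := (0 : ℝ)) (b := 1) (C := B)
      (f := fun x => x ^ j * g x) (fun x hx => ?_)
    · simpa using this
    · rw [Set.uIoc_of_le zero_le_one] at hx
      rw [Real.norm_eq_abs, abs_mul, abs_pow, abs_of_pos hx.1]
      calc x ^ j * |g x| ≤ 1 * |g x| :=
            mul_le_mul_of_nonneg_right (pow_le_one₀ hx.1.le hx.2) (abs_nonneg _)
        _ ≤ B := by rw [one_mul]; exact hB x ⟨hx.1.le, hx.2⟩
  rw [e, add_mul, Finset.sum_mul]
  refine (abs_add_le _ _).trans (add_le_add ((Finset.abs_sum_le_sum_abs _ _).trans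
    (Finset.sum_le_sum fun j _ => ?_)) ?_)
  · rw [abs_mul, mul_comm]
    exact mul_le_mul (hA j l hl s hs) (hm j) (abs_nonneg _) (hA0 j)
  · rw [abs_mul, mul_comm]
    exact mul_le_mul (hKB l hl s hs) (hB 1 (by simp)) (abs_nonneg _) hB0

/-! ### Approximation by the Gauss-Radau projection -/

theorem exists_taylor_polynomial (k : ℕ) {g : ℝ → ℝ} (hg : ContDiff ℝ ∞ g) (c : ℝ) :
    ∃ τ : ℝ[X], τ.natDegree ≤ k ∧
      (∀ l ≤ k, (derivative^[l] τ).eval c = iteratedDeriv l g c) ∧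
      ∀ x, x ≠ c → ∃ y ∈ Set.uIoo c x,
        g x - τ.eval x = iteratedDeriv (k + 1) g y * (x - c) ^ (k + 1) / (k + 1).factorial := by
  refine ⟨∑ n ∈ Finset.range (k + 1),
    C ((n.factorial : ℝ)⁻¹ * iteratedDeriv n g c) * (X - C c) ^ n, ?_, ?_, ?_⟩
  · refine natDegree_sum_le_of_forall_le _ _ fun n hn => (natDegree_C_mul_le _ _).trans ?_
    rw [natDegree_pow, natDegree_X_sub_C, mul_one]
    exact Nat.lt_succ_iff.mp (Finset.mem_range.mp hn)
  · intro l hl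
    rw [iterate_derivative_sum, eval_finsetSum, Finset.sum_eq_single l]
    · rw [iterate_derivative_C_mul, iterate_derivative_X_sub_pow]
      have : (l.factorial : ℝ) ≠ 0 := by positivity
      simp [Nat.descFactorial_self]
      field_simp
    · intro n _ hn
      rw [iterate_derivative_C_mul, iterate_derivative_X_sub_pow]
      rcases lt_or_gt_of_ne hn with h | h
      · rw [Nat.descFactorial_eq_zero_iff_lt.mpr h]; simp
      · have : n - l ≠ 0 := by omega
        simp [this]
    · intro h
      exact absurd (Finset.mem_range.mpr (by omega)) h
  · intro x hx
    obtain ⟨y, hy, h⟩ := taylor_mean_remainder_lagrange_iteratedDeriv (f := g) (n := k) hx.symm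
      ((contDiff_infty.mp hg (k + 1)).contDiffOn)
    refine ⟨y, hy, ?_⟩
    rw [← h, taylor_within_apply, eval_finsetSum]
    congr 1
    refine Finset.sum_congr rfl fun n _ => ?_
    rw [iteratedDerivWithin_eq_iteratedDeriv (uniqueDiffOn_uIcc hx.symm)
      (contDiff_infty.mp hg n).contDiffAt Set.left_mem_uIcc]
    simp
    ring

theorem exists_radau_error (k : ℕ) : ∃ K : ℝ, 0 ≤ K ∧ ∀ g : ℝ → ℝ, ContDiff ℝ ∞ g → ∀ B : ℝ,
    (∀ s ∈ Set.Icc (0 : ℝ) 1, |iteratedDeriv (k + 1) g s| ≤ B) → ∀ l ≤ k,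
      ∀ s ∈ Set.Icc (0 : ℝ) 1,
        |(derivative^[l] (radau k g)).eval s - iteratedDeriv l g s| ≤ K * B := by
  obtain ⟨K, hK0, hK⟩ := exists_abs_radau_le k
  refine ⟨K, hK0, fun g hg B hB l hl s hs => ?_⟩
  have hB0 : 0 ≤ B := (abs_nonneg _).trans (hB 0 (by simp))
  -- The Taylor polynomial is centred at the evaluation point `s`. There its derivatives agree with
  -- those of `g`, and the projection reproduces it, so the error at `s` is exactly a derivative of
  -- the projection of `g - τ`.
  obtain ⟨τ, hτ, hτd, hτr⟩ := exists_taylor_polynomial k hg s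
  have hle : ∀ x ∈ Set.Icc (0 : ℝ) 1, |g x - τ.eval x| ≤ B := by
    intro x hx
    rcases eq_or_ne x s with rfl | hne
    · have := hτd 0 (Nat.zero_le _)
      simp only [Function.iterate_zero, id, iteratedDeriv_zero] at this
      simpa [this] using hB0
    · obtain ⟨y, hy, h⟩ := hτr x hne
      have hy' : y ∈ Set.Icc (0 : ℝ) 1 :=
        Set.uIcc_subset_Icc hs hx ⟨hy.1.le, hy.2.le⟩
      have hd : |x - s| ≤ 1 := by
        rw [abs_le]; constructor <;> linarith [hx.1, hx.2, hs.1, hs.2]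
      have hf : (1 : ℝ) ≤ (k + 1).factorial := by exact_mod_cast Nat.succ_le_of_lt (Nat.factorial_pos _)
      rw [h, abs_div, abs_mul, abs_pow, Nat.abs_cast]
      refine (div_le_self (by positivity) hf).trans ?_
      calc _ ≤ B * 1 := mul_le_mul (hB y hy') (pow_le_one₀ (abs_nonneg _) hd) (by positivity) hB0
        _ = B := mul_one B
  have := hK (fun x => g x - τ.eval x) (hg.continuous.sub τ.continuous) B hle l hl s hs
  rwa [radau_sub k hg.continuous τ.continuous, radau_eval k hτ, iterate_map_sub, eval_sub,
    hτd l hl] at this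

theorem iteratedDeriv_comp_affine {G : ℝ → ℝ} (hG : ContDiff ℝ ∞ G) (l : ℕ) (y h s : ℝ) :
    iteratedDeriv l (fun s => G (y + h * s)) s = h ^ l * iteratedDeriv l G (y + h * s) := by
  have h1 : ContDiff ℝ l fun z => G (y + z) :=
    (contDiff_infty.mp hG l).comp (contDiff_const.add contDiff_id)
  have h2 := congrFun (iteratedDeriv_comp_const_mul h1 h) s
  rw [h2, iteratedDeriv_comp_const_add]

/-- Scaled error estimate of the Gauss-Radau projection on a cell `[y, y + h]`. -/
theorem exists_radau_error_cell (k : ℕ) : ∃ K : ℝ, 0 ≤ K ∧ ∀ G : ℝ → ℝ, ContDiff ℝ ∞ G →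
    ∀ y h B : ℝ, 0 ≤ h → (∀ x ∈ Set.Icc y (y + h), |iteratedDeriv (k + 1) G x| ≤ B) → ∀ l ≤ k,
      ∀ s ∈ Set.Icc (0 : ℝ) 1,
        |(derivative^[l] (radau k fun s => G (y + h * s))).eval s -
          h ^ l * iteratedDeriv l G (y + h * s)| ≤ K * B * h ^ (k + 1) := by
  obtain ⟨K, hK0, hK⟩ := exists_radau_error k
  refine ⟨K, hK0, fun G hG y h B hh hB l hl s hs => ?_⟩
  rw [← iteratedDeriv_comp_affine hG]
  have hc : ContDiff ℝ ∞ fun s => G (y + h * s) :=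
    hG.comp (contDiff_const.add (contDiff_const.mul contDiff_id))
  rw [mul_assoc]
  refine hK _ hc (B * h ^ (k + 1)) (fun x hx => ?_) l hl s hs
  rw [iteratedDeriv_comp_affine hG, abs_mul, abs_pow, abs_of_nonneg hh, mul_comm]
  refine mul_le_mul_of_nonneg_right (hB _ ⟨?_, ?_⟩) (by positivity)
  · nlinarith [hx.1]
  · nlinarith [hx.2]

/-! ### The exact solution -/

theorem hasDerivAt_integral_pow_mul {g : ℝ → ℝ} (hg : ContDiff ℝ ∞ g) (j : ℕ) (y h t : ℝ) :
    HasDerivAt (fun t => ∫ x in (0 : ℝ)..1, x ^ j * g (y + h * x - t))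
      (∫ x in (0 : ℝ)..1, x ^ j * -deriv g (y + h * x - t)) t := by
  have hd : Continuous (deriv g) := hg.continuous_deriv (by simp)
  have hgc := hg.continuous
  -- A constant dominating function, from compactness in `x` and in a unit neighbourhood of `t`.
  obtain ⟨B, hB⟩ := (isCompact_Icc.prod (isCompact_closedBall t 1)).exists_bound_of_continuousOn
    (f := fun p : ℝ × ℝ => p.1 ^ j * -deriv g (y + h * p.1 - p.2)) (s := Set.Icc (0 : ℝ) 1 ×ˢ _)
    (Continuous.continuousOn (by fun_prop))
  refine (intervalIntegral.hasDerivAt_integral_of_dominated_loc_of_deriv_le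
    (F := fun t x => x ^ j * g (y + h * x - t))
    (F' := fun t x => x ^ j * -deriv g (y + h * x - t)) (bound := fun _ => B)
    (Metric.ball_mem_nhds t one_pos) ?_ ?_ ?_ ?_ ?_ ?_).2
  · exact Filter.Eventually.of_forall fun s =>
      Continuous.aestronglyMeasurable (by fun_prop)
  · exact Continuous.intervalIntegrable (by fun_prop) _ _
  · exact Continuous.aestronglyMeasurable (by fun_prop)
  · refine Filter.Eventually.of_forall fun x hx s hs => ?_
    rw [Set.uIoc_of_le zero_le_one] at hx
    exact hB (x, s) ⟨⟨hx.1.le, hx.2⟩, Metric.ball_subset_closedBall hs⟩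
  · exact continuous_const.intervalIntegrable _ _
  · refine Filter.Eventually.of_forall fun x _ s _ => ?_
    have h1 : HasDerivAt g (deriv g (y + h * x - s)) (y + h * x - s) :=
      (hg.differentiable (by simp) _).hasDerivAt
    have h2 : HasDerivAt (fun s => y + h * x - s) (-1) s := by
      simpa using (hasDerivAt_id s).const_sub (y + h * x)
    have h3 := (h1.comp s h2).const_mul (x ^ j)
    simpa using h3

/-- Projection commutes with the time derivative of a travelling wave, because the formula for
`radau` is linear in moments and a point value. -/
theorem hasDerivAt_coeff_radau (k : ℕ) {g : ℝ → ℝ} (hg : ContDiff ℝ ∞ g) (n : ℕ) (y h t : ℝ) :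
    HasDerivAt (fun t => (radau k fun s => g (y + h * s - t)).coeff n)
      ((radau k fun s => -deriv g (y + h * s - t)).coeff n) t := by
  simp only [radau, coeff_add, finsetSum_coeff, coeff_C_mul]
  refine HasDerivAt.add (HasDerivAt.fun_sum fun j _ => ?_) ?_
  · exact (hasDerivAt_integral_pow_mul hg j y h t).mul_const _
  · have h1 : HasDerivAt g (deriv g (y + h * 1 - t)) (y + h * 1 - t) :=
      (hg.differentiable (by simp) _).hasDerivAt
    have h2 : HasDerivAt (fun s => y + h * 1 - s) (-1) t := by
      simpa using (hasDerivAt_id t).const_sub (y + h * 1)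
    have h3 := (h1.comp t h2).mul_const ((radauB k).coeff n)
    simpa using h3

theorem IsSmoothSolution.contDiff_initial {f : ℝ → ℝ} {a b T : ℝ} {bc : BoundaryCondition}
    {u : ℝ → ℝ → ℝ} (hT : 0 ≤ T) (hu : IsSmoothSolution f a b T bc u) :
    ContDiff ℝ ∞ fun x => u x 0 := by
  have h : ContDiff ℝ ∞ fun x : ℝ => (x, (0 : ℝ)) := contDiff_id.prodMk contDiff_const
  exact hu.smooth.comp_contDiff h fun x => ⟨trivial, le_rfl, hT⟩

/-- The solution is constant along the characteristics. -/
theorem IsSmoothSolution.eq_initial {a b T : ℝ} {bc : BoundaryCondition} {u : ℝ → ℝ → ℝ}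
    (hu : IsSmoothSolution linearSquare.f a b T bc u) (x : ℝ) {t : ℝ} (ht : t ∈ Set.Icc 0 T) :
    u x t = u (x - t) 0 := by
  rcases eq_or_lt_of_le ht.1 with rfl | ht0
  · simp
  let φ : ℝ → ℝ := fun s => u (x - t + s) s
  have hcont : ContinuousOn φ (Set.Icc 0 t) := by
    have : ContinuousOn (fun s : ℝ => (x - t + s, s)) (Set.Icc 0 t) :=
      Continuous.continuousOn (by fun_prop)
    exact hu.smooth.continuousOn.comp this fun s hs => ⟨trivial, hs.1, hs.2.trans ht.2⟩
  have hder : ∀ s ∈ Set.Ioo 0 t, HasDerivAt φ 0 s := by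
    intro s hs
    have hs' : s ∈ Set.Ioo 0 T := ⟨hs.1, hs.2.trans_le ht.2⟩
    -- Full differentiability holds only at interior times; continuity of `φ` covers the end points
    -- in the mean value theorem.
    have hnhds : (Set.univ ×ˢ Set.Icc 0 T : Set (ℝ × ℝ)) ∈ nhds (x - t + s, s) :=
      prod_mem_nhds Filter.univ_mem (Icc_mem_nhds hs'.1 hs'.2)
    have hD : DifferentiableAt ℝ (fun p : ℝ × ℝ => u p.1 p.2) (x - t + s, s) :=
      (hu.smooth.contDiffAt hnhds).differentiableAt (by simp)
    have hF := hD.hasFDerivAt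
    set D := fderiv ℝ (fun p : ℝ × ℝ => u p.1 p.2) (x - t + s, s)
    have h1 : HasDerivAt (fun r => u (x - t + s) r) (D (0, 1)) s :=
      hF.comp_hasDerivAt (x := s) (f := fun r => (x - t + s, r))
        ((hasDerivAt_const s _).prodMk (hasDerivAt_id s))
    have h2 : HasDerivAt (fun y => u y s) (D (1, 0)) (x - t + s) :=
      hF.comp_hasDerivAt (x := x - t + s) (f := fun y => (y, s))
        ((hasDerivAt_id _).prodMk (hasDerivAt_const _ s))
    have h3 : HasDerivAt φ (D (1, 1)) s :=
      hF.comp_hasDerivAt (x := s) (f := fun r => (x - t + r, r))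
        (((hasDerivAt_id s).const_add (x - t)).prodMk (hasDerivAt_id s))
    have hp := hu.pde (x - t + s) s hs'
    have h2' : deriv (fun y => linearSquare.f (u y s)) (x - t + s) = D (1, 0) := h2.deriv
    rw [h1.deriv, h2'] at hp
    have : D (1, 1) = 0 := by
      have e : ((1, 1) : ℝ × ℝ) = (0, 1) + (1, 0) := by simp
      rw [e, map_add, hp]
    rwa [this] at h3
  obtain ⟨c, hc, h⟩ := exists_deriv_eq_slope φ ht0 hcont
    fun s hs => (hder s hs).differentiableAt.differentiableWithinAt
  rw [(hder c hc).deriv, sub_zero] at h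
  have : φ t - φ 0 = 0 := by
    have := (div_eq_zero_iff.mp h.symm).resolve_right ht0.ne'
    exact this
  simp only [φ, sub_add_cancel, add_zero] at this
  linarith

/-- Uniform bounds for finitely many derivatives of the solution. -/
theorem exists_iteratedDeriv_bound {g : ℝ → ℝ} (hg : ContDiff ℝ ∞ g) (a b T : ℝ) (m : ℕ) :
    ∃ B : ℝ, 0 ≤ B ∧ ∀ l ≤ m, ∀ x ∈ Set.Icc a b, ∀ t ∈ Set.Icc 0 T,
      |iteratedDeriv l g (x - t)| ≤ B := by
  have h : ∀ l, ∃ K : ℝ, ∀ s ∈ Set.Icc (a - T) b, |iteratedDeriv l g s| ≤ K := fun l =>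
    isCompact_Icc.exists_bound_of_continuousOn
      ((contDiff_infty.mp hg l).continuous_iteratedDeriv l le_rfl).continuousOn
  choose K hK using h
  refine ⟨∑ l ∈ Finset.range (m + 1), |K l|, Finset.sum_nonneg fun l _ => abs_nonneg _,
    fun l hl x hx t ht => (hK l (x - t) ⟨by linarith [hx.1, ht.2], by linarith [hx.2, ht.1]⟩).trans
      ((le_abs_self _).trans ?_)⟩
  exact Finset.single_le_sum (f := fun l => |K l|) (fun l _ => abs_nonneg _)
    (Finset.mem_range.mpr (by omega))

/-! ### The scheme in the reference variable -/

theorem meshSize_pos {a b : ℝ} (hab : a < b) (N : ℕ) [NeZero N] : 0 < meshSize a b N :=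
  div_pos (sub_pos.mpr hab) (Nat.cast_pos.mpr (NeZero.pos N))

theorem xR_eq (a b : ℝ) {N : ℕ} (i : Fin N) : xR a b i = xL a b i + meshSize a b N := by
  rw [xR, xL]; ring

theorem integral_cell (a b : ℝ) {N : ℕ} (i : Fin N) (F : ℝ → ℝ) :
    ∫ x in (xL a b i)..(xR a b i), F x =
      meshSize a b N * ∫ s in (0 : ℝ)..1, F (xL a b i + meshSize a b N * s) := by
  have := intervalIntegral.smul_integral_comp_add_mul (a := 0) (b := 1) F (meshSize a b N)
    (xL a b i)
  rw [xR_eq, ← smul_eq_mul, this]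
  simp

/-- The pull-back of a polynomial on cell `i` to the reference cell. -/
noncomputable def toRef (a b : ℝ) {N : ℕ} (i : Fin N) (p : ℝ[X]) : ℝ[X] :=
  p.comp (C (xL a b i) + C (meshSize a b N) * X)

theorem eval_toRef (a b : ℝ) {N : ℕ} (i : Fin N) (p : ℝ[X]) (s : ℝ) :
    (toRef a b i p).eval s = p.eval (xL a b i + meshSize a b N * s) := by
  simp [toRef]

theorem natDegree_toRef_le (a b : ℝ) {N k : ℕ} (i : Fin N) {p : ℝ[X]} (hp : p.natDegree ≤ k) :
    (toRef a b i p).natDegree ≤ k := by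
  refine natDegree_comp_le.trans ?_
  have : (C (xL a b i) + C (meshSize a b N) * X : ℝ[X]).natDegree ≤ 1 := by compute_degree
  calc _ ≤ p.natDegree * 1 := Nat.mul_le_mul_left _ this
    _ ≤ k := by omega

theorem iterate_derivative_toRef (a b : ℝ) {N : ℕ} (i : Fin N) (p : ℝ[X]) (l : ℕ) :
    derivative^[l] (toRef a b i p) =
      C (meshSize a b N ^ l) * toRef a b i (derivative^[l] p) := by
  induction l with
  | zero => simp
  | succ l ih =>
    rw [Function.iterate_succ_apply', ih, Function.iterate_succ_apply']
    simp only [toRef, derivative_C_mul, derivative_comp]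
    simp [pow_succ]
    ring

theorem derivative_toRef (a b : ℝ) {N : ℕ} (i : Fin N) (p : ℝ[X]) :
    derivative (toRef a b i p) = C (meshSize a b N) * toRef a b i (derivative p) := by
  simpa using iterate_derivative_toRef a b i p 1

theorem coeff_toRef (a b : ℝ) {N k : ℕ} (i : Fin N) {p : ℝ[X]} (hp : p.natDegree ≤ k) (m : ℕ) :
    (toRef a b i p).coeff m = ∑ n ∈ Finset.range (k + 1),
      p.coeff n * ((C (xL a b i) + C (meshSize a b N) * X : ℝ[X]) ^ n).coeff m := by
  rw [toRef, comp_eq_sum_left, sum_over_range' _ (by simp) (k + 1) (Nat.lt_succ_of_le hp)]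
  simp only [finsetSum_coeff, coeff_C_mul]

theorem exists_toRef_eq {a b : ℝ} {N k : ℕ} (hh : meshSize a b N ≠ 0) (i : Fin N) {q : ℝ[X]}
    (hq : q.natDegree ≤ k) : ∃ φ : ℝ[X], φ.natDegree ≤ k ∧ toRef a b i φ = q := by
  refine ⟨q.comp (C (meshSize a b N)⁻¹ * (X - C (xL a b i))), ?_, ?_⟩
  · refine natDegree_comp_le.trans ?_
    have : (C (meshSize a b N)⁻¹ * (X - C (xL a b i)) : ℝ[X]).natDegree ≤ 1 := by compute_degree
    calc _ ≤ q.natDegree * 1 := Nat.mul_le_mul_left _ this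
      _ ≤ k := by omega
  · apply Polynomial.funext
    intro s
    rw [eval_toRef]
    simp only [eval_comp, eval_mul, eval_C, eval_sub, eval_X]
    congr 1
    field_simp
    ring

/-- The viscosity weight in the reference variable. -/
noncomputable def nuRef (s : ℝ) : ℝ := 1 - (2 * s - 1) ^ 2

theorem continuous_nuRef : Continuous nuRef := by unfold nuRef; fun_prop

theorem nuRef_mem {s : ℝ} (hs : s ∈ Set.Icc (0 : ℝ) 1) : 0 ≤ nuRef s ∧ nuRef s ≤ 1 := by
  unfold nuRef
  constructor <;> nlinarith [hs.1, hs.2, sq_nonneg (2 * s - 1)]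

theorem nu_eq_nuRef {a b : ℝ} {N : ℕ} (hh : meshSize a b N ≠ 0) (i : Fin N) (s : ℝ) :
    nu a b i (xL a b i + meshSize a b N * s) = nuRef s := by
  rw [nu, nuRef, xC, xR_eq]
  congr 2
  field_simp
  ring

/-- The wave speed is `1`, so the diffusive part turns the central flux into the upwind one. -/
theorem flux_linearSquare (um up : ℝ) : flux linearSquare um up = um := by
  have h : (fun s => |deriv linearSquare.f s|) = fun _ => 1 := by
    funext s; simp [linearSquare]
  have : ((fun _ : ℝ => (1 : ℝ)) '' Set.uIcc um up) = {1} := by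
    rw [Set.Nonempty.image_const Set.nonempty_uIcc]
  rw [flux, fluxC, fluxD, waveSpeed, h, this, csSup_singleton]
  simp only [linearSquare]
  ring

theorem coeffA_linearSquare (s : ℝ) : coeffA linearSquare s = 1 := by
  have hU : deriv linearSquare.U = fun s => s := by
    funext s; simp [linearSquare]
  rw [coeffA, hU]
  simp

/-- Under `x = x_L + h s` one derivative cancels the Jacobian `h`; the two derivatives of the
viscous term leave the factor `σ / h`. -/
theorem schemeRHS_linearSquare {a b : ℝ} (hab : a < b) (bc : BoundaryCondition) {k N : ℕ}
    [NeZero N] (C c₀ : ℝ) (w : Fin N → ℝ[X]) (i : Fin N) (hw : (w i).natDegree ≤ k) (φ : ℝ[X]) :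
    schemeRHS linearSquare bc k C c₀ a b w i φ =
      (∫ s in (0 : ℝ)..1, (toRef a b i (w i)).eval s * (derivative (toRef a b i φ)).eval s)
        - (toRef a b i (w i)).eval 1 * (toRef a b i φ).eval 1
        + outerL bc a b w i * (toRef a b i φ).eval 0
        - sigma linearSquare bc k C c₀ a b w i / meshSize a b N *
          ∫ s in (0 : ℝ)..1, nuRef s * (derivative (toRef a b i (w i))).eval s *
            (derivative (toRef a b i φ)).eval s := by
  have hh := (meshSize_pos hab N).ne'
  have hf : ∀ s, linearSquare.f s = s := fun _ => rfl
  rw [schemeRHS, integral_cell, integral_cell, flux_linearSquare, flux_linearSquare,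
    derivative_entropyVar hh w i hw]
  simp only [nu_eq_nuRef hh, coeffA_linearSquare, derivative_toRef, eval_mul, eval_C, eval_toRef,
    innerR, xR_eq, mul_one, mul_zero, add_zero, hf]
  rw [← intervalIntegral.integral_const_mul, ← intervalIntegral.integral_const_mul,
    ← intervalIntegral.integral_const_mul, ← intervalIntegral.integral_const_mul]
  congr 2
  · congr 2
    funext s; ring
  · funext s
    field_simp

/-- The scheme, tested with a polynomial in the reference variable. -/
theorem IsSolution.scheme_ref {a b T : ℝ} (hab : a < b) {bc : BoundaryCondition} {k N : ℕ}
    [NeZero N] {C c₀ : ℝ} {u₀ : ℝ → ℝ} {uh : ℝ → Fin N → ℝ[X]}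
    (h : IsSolution linearSquare bc k C c₀ a b T u₀ uh) {t : ℝ} (ht : t ∈ Set.Icc 0 T)
    (i : Fin N) {Wd : ℝ[X]}
    (hWd : ∀ s, derivWithin (fun τ => (toRef a b i (uh τ i)).eval s) (Set.Icc 0 T) t = Wd.eval s)
    (q : ℝ[X]) (hq : q.natDegree ≤ k) :
    meshSize a b N * ∫ s in (0 : ℝ)..1, Wd.eval s * q.eval s =
      (∫ s in (0 : ℝ)..1, (toRef a b i (uh t i)).eval s * (derivative q).eval s)
        - (toRef a b i (uh t i)).eval 1 * q.eval 1
        + outerL bc a b (uh t) i * q.eval 0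
        - sigma linearSquare bc k C c₀ a b (uh t) i / meshSize a b N *
          ∫ s in (0 : ℝ)..1, nuRef s * (derivative (toRef a b i (uh t i))).eval s *
            (derivative q).eval s := by
  obtain ⟨φ, hφ, rfl⟩ := exists_toRef_eq (meshSize_pos hab N).ne' i hq
  rw [← schemeRHS_linearSquare hab bc C c₀ (uh t) i (h.mem t ht i) φ, ← h.scheme t ht i φ hφ,
    integral_cell]
  simp only [← hWd, eval_toRef]

/-! ### Interface values -/

theorem xL_succ_or {a b : ℝ} {N : ℕ} [NeZero N] (i : Fin N) :
    ((i : ℕ) + 1 = N ∧ xR a b i = b ∧ xL a b (i + 1) = a) ∨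
      ((i : ℕ) + 1 ≠ N ∧ xL a b (i + 1) = xR a b i) := by
  obtain ⟨n, rfl⟩ : ∃ n, N = n + 1 := ⟨N - 1, by have := NeZero.pos N; omega⟩
  rcases eq_or_ne i (Fin.last n) with rfl | hi
  · left
    refine ⟨by simp, ?_, by simp [xL]⟩
    rw [xR, meshSize]
    push_cast [Fin.val_last]
    field_simp
    ring
  · right
    have hi' : (i : ℕ) ≠ n := fun h => hi (Fin.ext (by simpa using h))
    refine ⟨by omega, ?_⟩
    rw [xL, xR, Fin.val_add_one, if_neg hi]
    push_cast; ring

theorem xR_pred_or {a b : ℝ} {N : ℕ} [NeZero N] (i : Fin N) :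
    ((i : ℕ) = 0 ∧ xL a b i = a ∧ xR a b (i - 1) = b) ∨
      ((i : ℕ) ≠ 0 ∧ xR a b (i - 1) = xL a b i) := by
  have h := xL_succ_or (a := a) (b := b) (i - 1)
  rw [sub_add_cancel] at h
  rcases eq_or_ne i 0 with rfl | hi
  · left
    refine ⟨rfl, by simp [xL], ?_⟩
    obtain ⟨n, rfl⟩ : ∃ n, N = n + 1 := ⟨N - 1, by have := NeZero.pos N; omega⟩
    rcases h with h | h
    · exact h.2.1
    · exfalso
      apply h.1
      simp
  · right
    have hi' : (i : ℕ) ≠ 0 := fun h => hi (Fin.ext (by simpa using h))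
    refine ⟨hi', ?_⟩
    obtain ⟨n, rfl⟩ : ∃ n, N = n + 1 := ⟨N - 1, by have := NeZero.pos N; omega⟩
    rcases h with h | h
    · exfalso
      have h1 := h.1
      rw [Fin.coe_sub_one, if_neg hi] at h1
      have := i.2
      omega
    · exact h.2.symm

/-- Boundary values compatible with the boundary condition. -/
def BoundaryCompatible (bc : BoundaryCondition) (a b : ℝ) (D : ℝ → ℝ) : Prop :=
  match bc with
  | .periodic => D a = D b
  | .compactSupport => D a = 0 ∧ D b = 0

/-- Lets both boundary conditions be handled with cyclic indices. For compact support the left side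
is zero in the first cell, so an inequality is all that holds. -/
theorem abs_sub_outerL_le {bc : BoundaryCondition} {a b : ℝ} {D : ℝ → ℝ}
    (hD : BoundaryCompatible bc a b D) {N : ℕ} [NeZero N] (w : Fin N → ℝ[X]) (i : Fin N) :
    |D (xL a b i) - outerL bc a b w i| ≤ |D (xR a b (i - 1)) - innerR a b w (i - 1)| := by
  cases bc
  · have hD' : D a = D b := hD
    simp only [outerL]
    rcases xR_pred_or (a := a) (b := b) i with ⟨_, h1, h2⟩ | ⟨_, h⟩
    · rw [h1, h2, hD']
    · rw [h]
  · have hD' : D a = 0 ∧ D b = 0 := hD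
    simp only [outerL]
    rcases xR_pred_or (a := a) (b := b) i with ⟨h0, h1, h2⟩ | ⟨h0, h⟩
    · rw [if_pos h0, h1, hD'.1]
      simp
    · rw [if_neg h0, h]

theorem abs_outerR_sub_le {bc : BoundaryCondition} {a b : ℝ} {D : ℝ → ℝ}
    (hD : BoundaryCompatible bc a b D) {N : ℕ} [NeZero N] (w : Fin N → ℝ[X]) (i : Fin N) :
    |D (xR a b i) - outerR bc a b w i| ≤ |D (xL a b (i + 1)) - innerL a b w (i + 1)| := by
  cases bc
  · have hD' : D a = D b := hD
    simp only [outerR]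
    rcases xL_succ_or (a := a) (b := b) i with ⟨_, h1, h2⟩ | ⟨_, h⟩
    · rw [h1, h2, hD']
    · rw [h]
  · have hD' : D a = 0 ∧ D b = 0 := hD
    simp only [outerR]
    rcases xL_succ_or (a := a) (b := b) i with ⟨h0, h1, h2⟩ | ⟨h0, h⟩
    · rw [if_pos h0, h1, hD'.2]
      simp
    · rw [if_neg h0, h]

theorem IsSmoothSolution.boundaryCompatible {f : ℝ → ℝ} {a b T : ℝ} {bc : BoundaryCondition}
    {u : ℝ → ℝ → ℝ} (hu : IsSmoothSolution f a b T bc u) {t : ℝ} (ht : t ∈ Set.Icc 0 T) (l : ℕ) :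
    BoundaryCompatible bc a b (iteratedDeriv l fun x => u x t) := by
  have hb := hu.boundary
  cases bc
  · have hp : (fun x => u (x + (b - a)) t) = fun x => u x t := by
      funext x; exact hb x t ht
    have h := congrFun (iteratedDeriv_comp_add_const l (fun x => u x t) (b - a)) a
    rw [hp] at h
    simpa [BoundaryCompatible] using h
  -- Off the closed support the function vanishes in a neighbourhood, and therefore so do all its
  -- derivatives, also at `a` and `b`.
  · have key : ∀ x ∉ Set.Ioo a b, iteratedDeriv l (fun x => u x t) x = 0 := by
      intro x hx
      have : x ∉ tsupport fun x => u x t := fun h => hx (hb t ht h)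
      rw [notMem_tsupport_iff_eventuallyEq] at this
      rw [this.iteratedDeriv_eq l]
      have := iteratedDeriv_const (𝕜 := ℝ) (n := l) (c := (0 : ℝ)) (x := x)
      rwa [ite_self] at this
    exact ⟨key a (by simp), key b (by simp)⟩

/-! ### Bounds of the viscosity parameter -/

theorem sigmaJump_linearSquare {a b : ℝ} (hab : a < b) (bc : BoundaryCondition) (k : ℕ) (c₀ : ℝ)
    {N : ℕ} [NeZero N] (w : Fin N → ℝ[X]) (i : Fin N) :
    sigmaJump linearSquare bc k c₀ a b w i = c₀ *
      (meshSize a b N * jumpNorm bc a b w 0 i + ∑ l ∈ Finset.Icc 1 k,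
        (l : ℝ) * (l + 1) * meshSize a b N ^ (l + 1) * jumpNorm bc a b w l i) := by
  have h : (fun x => |deriv linearSquare.f ((w i).eval x)|) = fun _ => 1 := by
    funext s; simp [linearSquare]
  have hle : xL a b i ≤ xR a b i := by
    rw [xR_eq]; linarith [meshSize_pos hab N]
  have : ((fun _ : ℝ => (1 : ℝ)) '' Set.Icc (xL a b i) (xR a b i)) = {1} := by
    rw [Set.Nonempty.image_const (Set.nonempty_Icc.mpr hle)]
  rw [sigmaJump, h, this, csSup_singleton, mul_one]

theorem jumpNorm_nonneg (bc : BoundaryCondition) (a b : ℝ) {N : ℕ} [NeZero N] (w : Fin N → ℝ[X])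
    (l : ℕ) (i : Fin N) : 0 ≤ jumpNorm bc a b w l i := by
  unfold jumpNorm; positivity

/-- All that the error estimate needs to know about the entropy-based choice of `σ`. -/
theorem sigma_mem {a b : ℝ} (hab : a < b) (bc : BoundaryCondition) (k : ℕ) {C c₀ : ℝ}
    (hC : 1 < C) (hc₀ : 0 ≤ c₀) {N : ℕ} [NeZero N] (w : Fin N → ℝ[X]) (i : Fin N) :
    0 ≤ sigma linearSquare bc k C c₀ a b w i ∧
      sigma linearSquare bc k C c₀ a b w i ≤ C * sigmaJump linearSquare bc k c₀ a b w i := by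
  have hj : 0 ≤ sigmaJump linearSquare bc k c₀ a b w i := by
    rw [sigmaJump_linearSquare hab]
    have := (meshSize_pos hab N).le
    have hJ := fun l => jumpNorm_nonneg bc a b w l i
    exact mul_nonneg hc₀ (add_nonneg (mul_nonneg this (hJ 0)) (Finset.sum_nonneg fun l _ =>
      mul_nonneg (by positivity) (hJ l)))
  refine ⟨hj.trans (le_max_left _ _), max_le ?_ (min_le_right _ _)⟩
  nlinarith

/-- Inserting the single-valued derivative of `G` at each interface splits a jump of `w` into the
errors on its two sides. -/
theorem pow_mul_jumpNorm_le {bc : BoundaryCondition} {a b : ℝ} {G : ℝ → ℝ} {l N : ℕ}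
    (hG : BoundaryCompatible bc a b (iteratedDeriv l G)) [NeZero N] (hh : 0 ≤ meshSize a b N)
    (w : Fin N → ℝ[X]) (e : Fin N → ℝ)
    (he : ∀ i, ∀ s ∈ Set.Icc (0 : ℝ) 1, |meshSize a b N ^ l * (iteratedDeriv l G
      (xL a b i + meshSize a b N * s)) - (derivative^[l] (toRef a b i (w i))).eval s| ≤ e i)
    (i : Fin N) :
    meshSize a b N ^ l * jumpNorm bc a b w l i ≤ 2 * (e (i - 1) + e i + e (i + 1)) := by
  set h := meshSize a b N
  have hpow : 0 ≤ h ^ l := pow_nonneg hh l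
  let dw : Fin N → ℝ[X] := fun j => derivative^[l] (w j)
  have hL : ∀ i, h ^ l * |iteratedDeriv l G (xL a b i) - innerL a b dw i| ≤ e i := by
    intro i
    have := he i 0 (by simp)
    rw [iterate_derivative_toRef, eval_mul, eval_C, eval_toRef, ← mul_sub, abs_mul,
      abs_of_nonneg hpow, mul_zero, add_zero] at this
    exact this
  have hR : ∀ i, h ^ l * |iteratedDeriv l G (xR a b i) - innerR a b dw i| ≤ e i := by
    intro i
    have := he i 1 (by simp)
    rw [iterate_derivative_toRef, eval_mul, eval_C, eval_toRef, ← mul_sub, abs_mul,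
      abs_of_nonneg hpow, mul_one, ← xR_eq] at this
    exact this
  have hoL := (mul_le_mul_of_nonneg_left (abs_sub_outerL_le hG dw i) hpow).trans (hR (i - 1))
  have hoR := (mul_le_mul_of_nonneg_left (abs_outerR_sub_le hG dw i) hpow).trans (hL (i + 1))
  have h1 : |innerL a b dw i - outerL bc a b dw i| ≤
      |iteratedDeriv l G (xL a b i) - outerL bc a b dw i| +
        |iteratedDeriv l G (xL a b i) - innerL a b dw i| := by
    have := abs_sub (iteratedDeriv l G (xL a b i) - outerL bc a b dw i)
      (iteratedDeriv l G (xL a b i) - innerL a b dw i)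
    rwa [sub_sub_sub_cancel_left] at this
  have h2 : |outerR bc a b dw i - innerR a b dw i| ≤
      |iteratedDeriv l G (xR a b i) - innerR a b dw i| +
        |iteratedDeriv l G (xR a b i) - outerR bc a b dw i| := by
    have := abs_sub (iteratedDeriv l G (xR a b i) - innerR a b dw i)
      (iteratedDeriv l G (xR a b i) - outerR bc a b dw i)
    rwa [sub_sub_sub_cancel_left] at this
  have h1' := mul_le_mul_of_nonneg_left h1 hpow
  have h2' := mul_le_mul_of_nonneg_left h2 hpow
  have e0 := (mul_nonneg hpow (abs_nonneg _)).trans (hR (i - 1))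
  have e1 := (mul_nonneg hpow (abs_nonneg _)).trans (hL (i + 1))
  have hj : jumpNorm bc a b w l i =
    |innerL a b dw i - outerL bc a b dw i| + |outerR bc a b dw i - innerR a b dw i| := rfl
  rw [hj, mul_add]
  have := hL i
  have := hR i
  linarith [mul_add (h ^ l) |iteratedDeriv l G (xL a b i) - outerL bc a b dw i|
    |iteratedDeriv l G (xL a b i) - innerL a b dw i|, mul_add (h ^ l)
    |iteratedDeriv l G (xR a b i) - innerR a b dw i|
    |iteratedDeriv l G (xR a b i) - outerR bc a b dw i|]

/-- The viscosity parameter is controlled by the errors in the cell and its neighbours. -/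
theorem sigma_div_le {a b : ℝ} (hab : a < b) {bc : BoundaryCondition} {k : ℕ} {C c₀ : ℝ}
    (hC : 1 < C) (hc₀ : 0 ≤ c₀) {G : ℝ → ℝ}
    (hG : ∀ l, BoundaryCompatible bc a b (iteratedDeriv l G)) {N : ℕ} [NeZero N]
    (w : Fin N → ℝ[X]) (e : Fin N → ℝ)
    (he : ∀ i, ∀ l ≤ k, ∀ s ∈ Set.Icc (0 : ℝ) 1, |meshSize a b N ^ l * (iteratedDeriv l G
      (xL a b i + meshSize a b N * s)) - (derivative^[l] (toRef a b i (w i))).eval s| ≤ e i)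
    (i : Fin N) :
    sigma linearSquare bc k C c₀ a b w i / meshSize a b N ≤
      C * c₀ * (2 + ∑ l ∈ Finset.Icc 1 k, 2 * ((l : ℝ) * (l + 1))) *
        (e (i - 1) + e i + e (i + 1)) := by
  have hh := meshSize_pos hab N
  set h := meshSize a b N
  have hJ : ∀ l ≤ k, h ^ l * jumpNorm bc a b w l i ≤ 2 * (e (i - 1) + e i + e (i + 1)) :=
    fun l hl => pow_mul_jumpNorm_le (hG l) hh.le w e (fun i => he i l hl) i
  rw [div_le_iff₀ hh]
  refine (sigma_mem hab bc k hC hc₀ w i).2.trans ?_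
  rw [sigmaJump_linearSquare hab, mul_assoc C c₀, mul_assoc C, mul_assoc C, mul_assoc c₀,
    mul_assoc c₀]
  refine mul_le_mul_of_nonneg_left (mul_le_mul_of_nonneg_left ?_ hc₀) (by linarith)
  rw [add_mul, add_mul, Finset.sum_mul, Finset.sum_mul]
  refine add_le_add ?_ (Finset.sum_le_sum fun l hl => ?_)
  · have := mul_le_mul_of_nonneg_left (hJ 0 (Nat.zero_le _)) hh.le
    rw [pow_zero, one_mul] at this
    linarith
  · have := mul_le_mul_of_nonneg_left (hJ l (Finset.mem_Icc.mp hl).2)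
      (by positivity : 0 ≤ (l : ℝ) * (l + 1) * h)
    calc _ = (l : ℝ) * (l + 1) * h * (h ^ l * jumpNorm bc a b w l i) := by ring
      _ ≤ _ := this
      _ = _ := by ring

/-! ### The energy estimate -/

theorem pairing_self (p : ℝ[X]) : pairing p p = ∫ x in (0 : ℝ)..1, p.eval x ^ 2 := by
  simp only [pairing_apply, sq]

theorem pairing_self_nonneg (p : ℝ[X]) : 0 ≤ pairing p p := by
  rw [pairing_self]
  exact intervalIntegral.integral_nonneg zero_le_one fun x _ => sq_nonneg _

theorem integral_mul_derivative_self (p : ℝ[X]) :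
    ∫ x in (0 : ℝ)..1, p.eval x * (derivative p).eval x = (p.eval 1 ^ 2 - p.eval 0 ^ 2) / 2 := by
  rw [intervalIntegral.integral_eq_sub_of_hasDerivAt (f := fun x => p.eval x ^ 2 / 2)]
  · ring
  · intro x _
    refine (((p.hasDerivAt x).pow 2).div_const 2).congr_deriv ?_
    simp
    ring
  · exact Continuous.intervalIntegrable (by fun_prop) _ _

/-- The energy inequality on one cell. -/
theorem cell_energy {k : ℕ} {h s O : ℝ} (hs : 0 ≤ s) {g gt : ℝ → ℝ} (hg : ContDiff ℝ ∞ g)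
    (hgt : Continuous gt) (hder : ∀ x, h * gt x = -deriv g x) {W Wd ξ : ℝ[X]}
    (hW : W.natDegree ≤ k) (hξ : ξ = radau k g - W)
    (hscheme : ∀ q : ℝ[X], q.natDegree ≤ k → h * ∫ x in (0 : ℝ)..1, Wd.eval x * q.eval x =
      (∫ x in (0 : ℝ)..1, W.eval x * (derivative q).eval x) - W.eval 1 * q.eval 1
        + (g 0 - O) * q.eval 0
        - s * ∫ x in (0 : ℝ)..1, nuRef x * (derivative W).eval x * (derivative q).eval x) :
    h * pairing (radau k gt - Wd) ξ ≤
      h * (∫ x in (0 : ℝ)..1, ((radau k gt).eval x - gt x) * ξ.eval x)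
        + (O ^ 2 - ξ.eval 1 ^ 2) / 2
        + s * ∫ x in (0 : ℝ)..1,
            nuRef x * (derivative (radau k g)).eval x * (derivative ξ).eval x := by
  have hgc := hg.continuous
  have hgd : Continuous (deriv g) := hg.continuous_deriv (by simp)
  have hν := continuous_nuRef
  set p := radau k g with hp
  have hξk : ξ.natDegree ≤ k := by
    rw [hξ]; simpa using natDegree_sub_le_of_le (natDegree_radau_le k g) hW
  have I1 : pairing (radau k gt - Wd) ξ =
      (∫ x in (0 : ℝ)..1, ((radau k gt).eval x - gt x) * ξ.eval x) +
        (∫ x in (0 : ℝ)..1, gt x * ξ.eval x) - ∫ x in (0 : ℝ)..1, Wd.eval x * ξ.eval x := by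
    rw [pairing_apply, ← intervalIntegral.integral_add, ← intervalIntegral.integral_sub]
    · congr 1; funext x; rw [eval_sub]; ring
    all_goals exact Continuous.intervalIntegrable (by fun_prop) _ _
  have I2 : h * ∫ x in (0 : ℝ)..1, gt x * ξ.eval x =
      -(p.eval 1 * ξ.eval 1) + g 0 * ξ.eval 0 +
        ∫ x in (0 : ℝ)..1, g x * (derivative ξ).eval x := by
    have hparts : ∫ x in (0 : ℝ)..1, (deriv g x * ξ.eval x + g x * (derivative ξ).eval x) =
        g 1 * ξ.eval 1 - g 0 * ξ.eval 0 := by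
      rw [intervalIntegral.integral_eq_sub_of_hasDerivAt (f := fun x => g x * ξ.eval x)]
      · intro x _
        exact (hg.differentiable (by simp) x).hasDerivAt.mul (ξ.hasDerivAt x)
      · exact Continuous.intervalIntegrable (by fun_prop) _ _
    rw [intervalIntegral.integral_add] at hparts
    · have : h * ∫ x in (0 : ℝ)..1, gt x * ξ.eval x = -∫ x in (0 : ℝ)..1, deriv g x * ξ.eval x := by
        rw [← intervalIntegral.integral_const_mul, ← intervalIntegral.integral_neg]
        congr 1; funext x; rw [← mul_assoc, hder]; ring
      rw [this, hp, eval_one_radau]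
      linarith
    all_goals exact Continuous.intervalIntegrable (by fun_prop) _ _
  -- Moment condition of the projection: `ξ'` has degree below `k`, and is zero when `k = 0`.
  have I3 : ∫ x in (0 : ℝ)..1, g x * (derivative ξ).eval x =
      ∫ x in (0 : ℝ)..1, p.eval x * (derivative ξ).eval x := by
    rcases Nat.eq_zero_or_pos k with hk | hk
    · rw [derivative_of_natDegree_zero (by omega)]; simp
    · exact (integral_radau_mul k hgc (lt_of_le_of_lt (natDegree_derivative_le ξ) (by omega))).symm
  have I4 : ∫ x in (0 : ℝ)..1, p.eval x * (derivative ξ).eval x =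
      (∫ x in (0 : ℝ)..1, ξ.eval x * (derivative ξ).eval x) +
        ∫ x in (0 : ℝ)..1, W.eval x * (derivative ξ).eval x := by
    rw [← intervalIntegral.integral_add]
    · congr 1; funext x; rw [hξ, eval_sub]; ring
    all_goals exact Continuous.intervalIntegrable (by fun_prop) _ _
  have I5 : ∫ x in (0 : ℝ)..1, nuRef x * (derivative W).eval x * (derivative ξ).eval x =
      (∫ x in (0 : ℝ)..1, nuRef x * (derivative p).eval x * (derivative ξ).eval x) -
        ∫ x in (0 : ℝ)..1, nuRef x * (derivative ξ).eval x ^ 2 := by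
    rw [← intervalIntegral.integral_sub]
    · congr 1; funext x
      have : (derivative ξ).eval x = (derivative p).eval x - (derivative W).eval x := by
        rw [hξ, derivative_sub, eval_sub]
      rw [this]; ring
    all_goals exact Continuous.intervalIntegrable (by fun_prop) _ _
  have I6 : 0 ≤ ∫ x in (0 : ℝ)..1, nuRef x * (derivative ξ).eval x ^ 2 :=
    intervalIntegral.integral_nonneg zero_le_one fun x hx =>
      mul_nonneg (nuRef_mem hx).1 (sq_nonneg _)
  have hsc := hscheme ξ hξk
  rw [integral_mul_derivative_self] at I4
  rw [I5] at hsc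
  have hW1 : W.eval 1 = p.eval 1 - ξ.eval 1 := by rw [hξ, eval_sub]; ring
  rw [I1, mul_sub, mul_add, I2, hsc, I3, I4, hW1]
  -- The boundary terms are `O ξ(0) - ξ(0)²/2 - ξ(1)²/2`, and `O ξ(0) - ξ(0)²/2 ≤ O²/2`. The
  -- dissipation `s ∫ ν ξ'²` is dropped.
  nlinarith [sq_nonneg (O - ξ.eval 0), mul_nonneg hs I6]

theorem sum_cyclic_mul_le {N : ℕ} [NeZero N] (e : Fin N → ℝ) :
    ∑ i, (e (i - 1) + e i + e (i + 1)) * e i ≤ 3 * ∑ i, e i ^ 2 := by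
  have h1 : ∑ i, e (i - 1) ^ 2 = ∑ i, e i ^ 2 :=
    Equiv.sum_comp (Equiv.subRight (1 : Fin N)) fun i => e i ^ 2
  have h2 : ∑ i, e (i + 1) ^ 2 = ∑ i, e i ^ 2 :=
    Equiv.sum_comp (Equiv.addRight (1 : Fin N)) fun i => e i ^ 2
  have h3 : ∑ i, (e (i - 1) + e i + e (i + 1)) * e i ≤
      ∑ i, (e (i - 1) ^ 2 / 2 + 2 * e i ^ 2 + e (i + 1) ^ 2 / 2) := by
    refine Finset.sum_le_sum fun i _ => ?_
    nlinarith [sq_nonneg (e (i - 1) - e i), sq_nonneg (e (i + 1) - e i)]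
  rw [Finset.sum_add_distrib, Finset.sum_add_distrib, ← Finset.sum_div, ← Finset.sum_div,
    ← Finset.mul_sum, h1, h2] at h3
  linarith

theorem Icc_cell_subset {a b : ℝ} (hab : a < b) {N : ℕ} [NeZero N] (i : Fin N) :
    Set.Icc (xL a b i) (xL a b i + meshSize a b N) ⊆ Set.Icc a b := by
  have hh := meshSize_pos hab N
  have hN : (N : ℝ) * meshSize a b N = b - a := by
    have : (N : ℝ) ≠ 0 := Nat.cast_ne_zero.mpr (NeZero.ne N)
    rw [meshSize]; field_simp
  have hi : ((i : ℕ) : ℝ) + 1 ≤ N := by exact_mod_cast i.2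
  intro x hx
  rw [xL] at hx
  have h0 : 0 ≤ ((i : ℕ) : ℝ) * meshSize a b N := by positivity
  constructor
  · linarith [hx.1]
  · nlinarith [hx.2]

theorem card_mul_meshSize (a b : ℝ) (N : ℕ) [NeZero N] : (N : ℝ) * meshSize a b N = b - a := by
  have : (N : ℝ) ≠ 0 := Nat.cast_ne_zero.mpr (NeZero.ne N)
  rw [meshSize]; field_simp

theorem meshSize_le {a b : ℝ} (hab : a < b) (N : ℕ) [NeZero N] : meshSize a b N ≤ b - a := by
  have hN : (1 : ℝ) ≤ N := by exact_mod_cast NeZero.pos N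
  have := card_mul_meshSize a b N
  nlinarith [meshSize_pos hab N]

/-- The Gauss-Radau projection of a function on cell `i`, in the reference variable. -/
noncomputable def cellProj (k : ℕ) (a b : ℝ) {N : ℕ} (i : Fin N) (G : ℝ → ℝ) : ℝ[X] :=
  radau k fun s => G (xL a b i + meshSize a b N * s)

theorem natDegree_cellProj_le (k : ℕ) (a b : ℝ) {N : ℕ} (i : Fin N) (G : ℝ → ℝ) :
    (cellProj k a b i G).natDegree ≤ k := natDegree_radau_le k _

theorem exists_cellProj_error (k : ℕ) {a b : ℝ} (hab : a < b) : ∃ K : ℝ, 0 ≤ K ∧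
    ∀ G : ℝ → ℝ, ContDiff ℝ ∞ G → ∀ B : ℝ,
    (∀ x ∈ Set.Icc a b, |iteratedDeriv (k + 1) G x| ≤ B) → ∀ (N : ℕ) [NeZero N] (i : Fin N),
    ∀ l ≤ k, ∀ s ∈ Set.Icc (0 : ℝ) 1,
      |(derivative^[l] (cellProj k a b i G)).eval s -
        meshSize a b N ^ l * iteratedDeriv l G (xL a b i + meshSize a b N * s)| ≤
          K * B * meshSize a b N ^ (k + 1) := by
  obtain ⟨K, hK0, hK⟩ := exists_radau_error_cell k
  exact ⟨K, hK0, fun G hG B hB N _ i => hK G hG (xL a b i) (meshSize a b N) B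
    (meshSize_pos hab N).le fun x hx => hB x (Icc_cell_subset hab i hx)⟩

/-- A derivative in the reference variable is `h G'` up to the projection error `O(h^{k+1})`. This
factor `h` lets the viscous term survive the division of the energy inequality by `h`. -/
theorem exists_derivative_cellProj_le (k : ℕ) {a b : ℝ} (hab : a < b) {B : ℝ} (hB0 : 0 ≤ B) :
    ∃ K : ℝ, 0 ≤ K ∧ ∀ G : ℝ → ℝ, ContDiff ℝ ∞ G →
    (∀ l ≤ k + 2, ∀ x ∈ Set.Icc a b, |iteratedDeriv l G x| ≤ B) →
    ∀ (N : ℕ) [NeZero N] (i : Fin N), ∀ s ∈ Set.Icc (0 : ℝ) 1,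
      |(derivative (cellProj k a b i G)).eval s| ≤ K * meshSize a b N := by
  obtain ⟨K, hK0, hK⟩ := exists_cellProj_error k hab
  have hba : 0 ≤ b - a := by linarith
  refine ⟨K * B * (b - a) ^ k + B, by positivity, fun G hG hB N _ i s hs => ?_⟩
  have hh := meshSize_pos hab N
  rcases Nat.eq_zero_or_pos k with rfl | hk
  · rw [derivative_of_natDegree_zero (Nat.le_zero.mp (natDegree_cellProj_le 0 a b i G)), eval_zero, abs_zero]
    positivity
  · have h1 := hK G hG B (hB (k + 1) (by omega)) N i 1 hk s hs
    rw [Function.iterate_one, pow_one] at h1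
    have hx : xL a b i + meshSize a b N * s ∈ Set.Icc a b :=
      Icc_cell_subset hab i ⟨by nlinarith [hs.1], by nlinarith [hs.2]⟩
    have h2 : |meshSize a b N * iteratedDeriv 1 G (xL a b i + meshSize a b N * s)| ≤
        meshSize a b N * B := by
      rw [abs_mul, abs_of_pos hh]
      exact mul_le_mul_of_nonneg_left (hB 1 (by omega) _ hx) hh.le
    have h3 : meshSize a b N ^ (k + 1) ≤ (b - a) ^ k * meshSize a b N := by
      rw [pow_succ]
      exact mul_le_mul_of_nonneg_right (pow_le_pow_left₀ hh.le (meshSize_le hab N) k) hh.le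
    have h4 := mul_le_mul_of_nonneg_left h3 (mul_nonneg hK0 hB0)
    have h5 := abs_sub_abs_le_abs_sub ((derivative (cellProj k a b i G)).eval s)
      (meshSize a b N * iteratedDeriv 1 G (xL a b i + meshSize a b N * s))
    linarith

/-- Growth of the error energy at a fixed time. -/
theorem exists_energy_rate {a b : ℝ} (hab : a < b) (k : ℕ) {C c₀ : ℝ} (hC : 1 < C) (hc₀ : 0 ≤ c₀)
    {B : ℝ} (hB0 : 0 ≤ B) : ∃ K : ℝ, 0 ≤ K ∧ ∀ (bc : BoundaryCondition) (G : ℝ → ℝ),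
      ContDiff ℝ ∞ G → (∀ l ≤ k + 2, ∀ x ∈ Set.Icc a b, |iteratedDeriv l G x| ≤ B) →
      (∀ l, BoundaryCompatible bc a b (iteratedDeriv l G)) →
      ∀ (N : ℕ) [NeZero N] (w Wd ξ : Fin N → ℝ[X]), (∀ i, (w i).natDegree ≤ k) →
      (∀ i, ξ i = cellProj k a b i G - toRef a b i (w i)) →
      (∀ i, ∀ q : ℝ[X], q.natDegree ≤ k →
        meshSize a b N * ∫ s in (0 : ℝ)..1, (Wd i).eval s * q.eval s =
          (∫ s in (0 : ℝ)..1, (toRef a b i (w i)).eval s * (derivative q).eval s)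
            - (toRef a b i (w i)).eval 1 * q.eval 1
            + outerL bc a b w i * q.eval 0
            - sigma linearSquare bc k C c₀ a b w i / meshSize a b N *
              ∫ s in (0 : ℝ)..1, nuRef s * (derivative (toRef a b i (w i))).eval s *
                (derivative q).eval s) →
      ∑ i, pairing (cellProj k a b i (fun x => -deriv G x) - Wd i) (ξ i) ≤
        K * (∑ i, pairing (ξ i) (ξ i) + N * (meshSize a b N ^ (k + 1)) ^ 2) := by
  obtain ⟨KR, hKR0, hKR⟩ := exists_cellProj_error k hab
  obtain ⟨KP, hKP0, hKP⟩ := exists_derivative_cellProj_le k hab hB0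
  -- Degree `k + 1` rather than `k`, so that the first derivative is covered also when `k = 0`.
  obtain ⟨KI, hKI0, hKI⟩ := exists_inverse_inequality (k + 1)
  set KA := KR * B with hKA
  have hKA0 : 0 ≤ KA := mul_nonneg hKR0 hB0
  set S := C * c₀ * (2 + ∑ l ∈ Finset.Icc 1 k, 2 * ((l : ℝ) * (l + 1))) with hS
  have hS0 : 0 ≤ S := by
    have : 0 ≤ ∑ l ∈ Finset.Icc 1 k, 2 * ((l : ℝ) * (l + 1)) :=
      Finset.sum_nonneg fun l _ => by positivity
    have : 0 < C := by linarith
    positivity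
  -- The `3` comes from `sum_cyclic_mul_le`, the `2` from `(α + δ)² ≤ 2α² + 2δ²`.
  refine ⟨2 * (KA + S * (KA + KI) * (KP * KI) * 3), by positivity,
    fun bc G hG hGB hGbc N _ w Wd ξ hw hξ hsch => ?_⟩
  have hh := meshSize_pos hab N
  set h := meshSize a b N with hhdef
  set δ := h ^ (k + 1) with hδ
  have hδ0 : 0 ≤ δ := by positivity
  set α : Fin N → ℝ := fun i => Real.sqrt (∫ x in (0 : ℝ)..1, (ξ i).eval x ^ 2) with hα
  have hα0 : ∀ i, 0 ≤ α i := fun i => Real.sqrt_nonneg _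
  have hα2 : ∀ i, α i ^ 2 = pairing (ξ i) (ξ i) := fun i => by
    rw [hα, pairing_self, Real.sq_sqrt]
    rw [← pairing_self]; exact pairing_self_nonneg _
  have hξk : ∀ i, (ξ i).natDegree ≤ k := fun i => by
    rw [hξ]
    simpa using natDegree_sub_le_of_le (natDegree_cellProj_le k a b i G) (natDegree_toRef_le a b i (hw i))
  have hinv : ∀ i, ∀ l ≤ k + 1, ∀ s ∈ Set.Icc (0 : ℝ) 1,
      |(derivative^[l] (ξ i)).eval s| ≤ KI * α i := fun i =>
    hKI (ξ i) ((hξk i).trans (Nat.le_succ k))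
  set e : Fin N → ℝ := fun i => α i + δ with he
  have hsigma : ∀ i, sigma linearSquare bc k C c₀ a b w i / h ≤
      S * (KA + KI) * (e (i - 1) + e i + e (i + 1)) := by
    intro i
    have := sigma_div_le hab hC hc₀ hGbc w (fun i => (KA + KI) * e i) (k := k) (fun i l hl s hs => ?_) i
    · refine this.trans (le_of_eq ?_)
      rw [hS]; ring
    · have h1 := hKR G hG B (hGB (k + 1) (by omega)) N i l hl s hs
      have h2 := hinv i l (by omega) s hs
      rw [hξ, iterate_map_sub, eval_sub] at h2
      rw [abs_sub_comm] at h1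
      have h3 := abs_add_le (h ^ l * iteratedDeriv l G (xL a b i + h * s) -
        (derivative^[l] (cellProj k a b i G)).eval s)
        ((derivative^[l] (cellProj k a b i G)).eval s -
          (derivative^[l] (toRef a b i (w i))).eval s)
      rw [sub_add_sub_cancel] at h3
      have h4 := mul_nonneg hKA0 (hα0 i)
      have h5 := mul_nonneg hKI0 hδ0
      refine h3.trans ?_
      simp only [he]
      rw [← hhdef, ← hδ, ← hKA] at h1
      linarith [add_mul KA KI (α i + δ), mul_add KA (α i) δ, mul_add KI (α i) δ]
  -- The term `3 e_i²` is added and subtracted so that the second summand has a nonpositive sum over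
  -- the cells.
  have hcell : ∀ i, h * pairing (cellProj k a b i (fun x => -deriv G x) - Wd i) (ξ i) ≤
      h * ((KA + S * (KA + KI) * (KP * KI) * 3) * e i ^ 2 +
        S * (KA + KI) * (KP * KI) * ((e (i - 1) + e i + e (i + 1)) * e i - 3 * e i ^ 2)) +
        ((ξ (i - 1)).eval 1 ^ 2 - (ξ i).eval 1 ^ 2) / 2 := by
    intro i
    have hGd : ContDiff ℝ ∞ (deriv G) := (contDiff_infty_iff_deriv.mp hG).2
    have hgc : ContDiff ℝ ∞ fun s => G (xL a b i + h * s) :=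
      hG.comp (contDiff_const.add (contDiff_const.mul contDiff_id))
    have hgt : Continuous fun s => -deriv G (xL a b i + h * s) := by
      have := hGd.continuous; fun_prop
    have hder : ∀ x, h * -deriv G (xL a b i + h * x) =
        -deriv (fun s => G (xL a b i + h * s)) x := by
      intro x
      have := iteratedDeriv_comp_affine hG 1 (xL a b i) h x
      rw [iteratedDeriv_one, iteratedDeriv_one, pow_one] at this
      rw [this]; ring
    set O := G (xL a b i) - outerL bc a b w i with hO
    have hs0 : 0 ≤ sigma linearSquare bc k C c₀ a b w i / h :=
      div_nonneg (sigma_mem hab bc k hC hc₀ w i).1 hh.le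
    have hmain := cell_energy (k := k) (O := O) hs0 hgc hgt hder (natDegree_toRef_le a b i (hw i))
      (hξ i) (Wd := Wd i) (fun q hq => by
        rw [hsch i q hq, hO, mul_zero, add_zero, sub_sub_cancel])
    -- The projection is exact at right end points, so `ξ_{i-1}(1)` is the full error on the upwind
    -- side of the interface.
    have hO2 : O ^ 2 ≤ (ξ (i - 1)).eval 1 ^ 2 := by
      have h1 := abs_sub_outerL_le (D := G) (by simpa using hGbc 0) w i
      have h2 : (ξ (i - 1)).eval 1 = G (xR a b (i - 1)) - innerR a b w (i - 1) := by
        rw [hξ, eval_sub, cellProj, eval_one_radau, eval_toRef, mul_one, ← xR_eq, innerR]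
      rw [← h2] at h1
      exact sq_le_sq.mpr h1
    have hT1 : ∫ x in (0 : ℝ)..1, ((radau k fun s => -deriv G (xL a b i + h * s)).eval x -
        -deriv G (xL a b i + h * x)) * (ξ i).eval x ≤ KA * δ * α i := by
      refine (le_abs_self _).trans (abs_integral_mul_le (by fun_prop) (ξ i).continuous ?_)
      intro x hx
      have := hKR (fun x => -deriv G x) hGd.neg B (fun x hx => ?_) N i 0 (Nat.zero_le _) x hx
      · simpa [cellProj] using this
      -- The projection error of `u_t = -u_x` is why bounds up to order `k + 2` are assumed.
      · have e1 : iteratedDeriv (k + 1) (fun x => -deriv G x) x = -iteratedDeriv (k + 2) G x := by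
          rw [iteratedDeriv_succ' (n := k + 1)]
          exact iteratedDeriv_neg (k + 1) (deriv G) x
        rw [e1, abs_neg]
        exact hGB (k + 2) le_rfl x hx
    have hT2 : ∫ x in (0 : ℝ)..1, nuRef x * (derivative (cellProj k a b i G)).eval x *
        (derivative (ξ i)).eval x ≤ KP * h * (KI * α i) := by
      have hν := continuous_nuRef
      refine (le_abs_self _).trans ((abs_integral_mul_le (B := KP * h) (by fun_prop)
        (derivative (ξ i)).continuous ?_).trans ?_)
      · intro x hx
        rw [abs_mul, abs_of_nonneg (nuRef_mem hx).1]
        calc _ ≤ 1 * (KP * h) := mul_le_mul (nuRef_mem hx).2 (hKP G hG hGB N i x hx)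
              (abs_nonneg _) zero_le_one
          _ = _ := one_mul _
      · refine mul_le_mul_of_nonneg_left ?_ (by positivity)
        rw [← Real.sqrt_sq (mul_nonneg hKI0 (hα0 i))]
        apply Real.sqrt_le_sqrt
        have : ∫ x in (0 : ℝ)..1, (derivative (ξ i)).eval x ^ 2 ≤
            ∫ x in (0 : ℝ)..1, (KI * α i) ^ 2 := by
          apply intervalIntegral.integral_mono_on zero_le_one
          · exact Continuous.intervalIntegrable (by fun_prop) _ _
          · exact continuous_const.intervalIntegrable _ _
          · intro x hx
            rw [← sq_abs]
            exact pow_le_pow_left₀ (abs_nonneg _) (hinv i 1 (by omega) x hx) 2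
        simpa using this
    have hE : α i ≤ e i := by simp only [he]; linarith
    have hE' : δ ≤ e i := by simp only [he]; linarith [hα0 i]
    have hE0 : ∀ j, 0 ≤ e j := fun j => add_nonneg (hα0 j) hδ0
    have hA1 : KA * δ * α i ≤ KA * e i ^ 2 := by
      rw [mul_assoc, sq]
      exact mul_le_mul_of_nonneg_left (mul_le_mul hE' hE (hα0 i) (hE0 i)) hKA0
    have hA2 : sigma linearSquare bc k C c₀ a b w i / h *
        (∫ x in (0 : ℝ)..1, nuRef x * (derivative (cellProj k a b i G)).eval x *
        (derivative (ξ i)).eval x) ≤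
        S * (KA + KI) * (e (i - 1) + e i + e (i + 1)) * (KP * h * (KI * e i)) := by
      refine (mul_le_mul_of_nonneg_left hT2 hs0).trans
        (mul_le_mul (hsigma i) ?_ (by have := hα0 i; positivity) (by
          have := hE0 (i - 1); have := hE0 i; have := hE0 (i + 1); positivity))
      exact mul_le_mul_of_nonneg_left (mul_le_mul_of_nonneg_left hE hKI0) (by positivity)
    have hA3 := mul_le_mul_of_nonneg_left (hT1.trans hA1) hh.le
    have hmain' : h * pairing (cellProj k a b i (fun x => -deriv G x) - Wd i) (ξ i) ≤ _ := hmain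
    refine hmain'.trans ?_
    have hA2' : sigma linearSquare bc k C c₀ a b w i / h *
        (∫ x in (0 : ℝ)..1, nuRef x *
          (derivative (radau k fun s => G (xL a b i + h * s))).eval x *
        (derivative (ξ i)).eval x) ≤ _ := hA2
    nlinarith
  have hsum := Finset.sum_le_sum fun i (_ : i ∈ Finset.univ) => hcell i
  rw [← Finset.mul_sum, Finset.sum_add_distrib, ← Finset.mul_sum, ← Finset.sum_div,
    Finset.sum_sub_distrib, Finset.sum_add_distrib, ← Finset.mul_sum, ← Finset.mul_sum,
    Finset.sum_sub_distrib, ← Finset.mul_sum] at hsum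
  have hshift : ∑ i, (ξ (i - 1)).eval 1 ^ 2 = ∑ i, (ξ i).eval 1 ^ 2 :=
    Equiv.sum_comp (Equiv.subRight (1 : Fin N)) fun i => (ξ i).eval 1 ^ 2
  rw [hshift, sub_self, zero_div, add_zero] at hsum
  have hsum' := le_of_mul_le_mul_left hsum hh
  have hcyc := sum_cyclic_mul_le e
  have hcyc' : S * (KA + KI) * (KP * KI) *
      (∑ i, (e (i - 1) + e i + e (i + 1)) * e i - 3 * ∑ i, e i ^ 2) ≤ 0 :=
    mul_nonpos_of_nonneg_of_nonpos (by positivity) (by linarith)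
  have he2 : ∑ i, e i ^ 2 ≤ 2 * (∑ i, pairing (ξ i) (ξ i) + N * δ ^ 2) := by
    calc ∑ i, e i ^ 2 ≤ ∑ i, (2 * pairing (ξ i) (ξ i) + 2 * δ ^ 2) := by
          refine Finset.sum_le_sum fun i _ => ?_
          rw [← hα2]
          simp only [he]
          nlinarith [sq_nonneg (α i - δ)]
      _ = _ := by
          rw [Finset.sum_add_distrib, ← Finset.mul_sum]
          simp
          ring
  have hfin := mul_le_mul_of_nonneg_left he2
    (by positivity : 0 ≤ KA + S * (KA + KI) * (KP * KI) * 3)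
  linarith

/-! ### Evolution of the energy -/

/-- Reduces the time regularity of the energy to that of finitely many scalar coefficients. -/
theorem pairing_eq_sum {k : ℕ} {p q : ℝ[X]} (hp : p.natDegree ≤ k) (hq : q.natDegree ≤ k) :
    pairing p q = ∑ n ∈ Finset.range (k + 1), ∑ m ∈ Finset.range (k + 1),
      p.coeff n * q.coeff m * pairing (X ^ n) (X ^ m) := by
  have hr : ∀ r s : ℝ[X], s.natDegree ≤ k → pairing r s = ∑ m ∈ Finset.range (k + 1),
      s.coeff m * pairing r (X ^ m) := by
    intro r s hs
    conv_lhs => rw [s.as_sum_range_C_mul_X_pow' (Nat.lt_succ_of_le hs)]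
    simp only [map_sum, ← smul_eq_C_mul, map_smul, smul_eq_mul]
  rw [pairing_comm, hr q p hp]
  refine Finset.sum_congr rfl fun n _ => ?_
  rw [pairing_comm, hr _ q hq, Finset.mul_sum]
  refine Finset.sum_congr rfl fun m _ => by ring

theorem hasDerivAt_pairing_self {k : ℕ} {F : ℝ → ℝ[X]} {F' : ℝ[X]} {t : ℝ}
    (hF : ∀ᶠ τ in nhds t, (F τ).natDegree ≤ k) (hF' : F'.natDegree ≤ k)
    (hc : ∀ n, HasDerivAt (fun τ => (F τ).coeff n) (F'.coeff n) t) :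
    HasDerivAt (fun τ => pairing (F τ) (F τ)) (2 * pairing F' (F t)) t := by
  have hev : (fun τ => pairing (F τ) (F τ)) =ᶠ[nhds t] fun τ =>
      ∑ n ∈ Finset.range (k + 1), ∑ m ∈ Finset.range (k + 1),
        (F τ).coeff n * (F τ).coeff m * pairing (X ^ n) (X ^ m) :=
    hF.mono fun τ hτ => pairing_eq_sum hτ hτ
  refine HasDerivAt.congr_of_eventuallyEq ?_ hev
  have hd : HasDerivAt (fun τ =>
      ∑ n ∈ Finset.range (k + 1), ∑ m ∈ Finset.range (k + 1),
        (F τ).coeff n * (F τ).coeff m * pairing (X ^ n) (X ^ m)) _ t :=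
    HasDerivAt.fun_sum fun n _ => HasDerivAt.fun_sum fun m _ =>
      ((hc n).mul (hc m)).mul_const _
  refine hd.congr_deriv ?_
  have hFt := hF.self_of_nhds
  simp only [add_mul, Finset.sum_add_distrib]
  rw [← pairing_eq_sum hF' hFt, ← pairing_eq_sum hFt hF', pairing_comm (F t)]
  ring

theorem continuousOn_pairing_self {k : ℕ} {F : ℝ → ℝ[X]} {s : Set ℝ}
    (hF : ∀ τ ∈ s, (F τ).natDegree ≤ k)
    (hc : ∀ n, ContinuousOn (fun τ => (F τ).coeff n) s) :
    ContinuousOn (fun τ => pairing (F τ) (F τ)) s := by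
  refine ContinuousOn.congr (f := fun τ =>
      ∑ n ∈ Finset.range (k + 1), ∑ m ∈ Finset.range (k + 1),
        (F τ).coeff n * (F τ).coeff m * pairing (X ^ n) (X ^ m)) ?_
    fun τ hτ => pairing_eq_sum (hF τ hτ) (hF τ hτ)
  exact continuousOn_finsetSum _ fun n _ => continuousOn_finsetSum _ fun m _ =>
    ((hc n).mul (hc m)).mul continuousOn_const

/-- Grönwall: `exp(-K t) (E + D)` is nonincreasing. The derivative is needed only at interior times.
-/
theorem le_exp_mul_of_deriv_le {E E' : ℝ → ℝ} {T K D : ℝ} (hE : ContinuousOn E (Set.Icc 0 T))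
    (hE' : ∀ t ∈ Set.Ioo 0 T, HasDerivAt E (E' t) t)
    (hle : ∀ t ∈ Set.Ioo 0 T, E' t ≤ K * (E t + D)) {t : ℝ} (ht : t ∈ Set.Icc 0 T) :
    E t + D ≤ Real.exp (K * t) * (E 0 + D) := by
  have hd : ∀ t ∈ Set.Ioo 0 T, HasDerivAt (fun t => Real.exp (-K * t) * (E t + D))
      (Real.exp (-K * t) * (E' t - K * (E t + D))) t := by
    intro t ht
    have h1 : HasDerivAt (fun t => Real.exp (-K * t)) (Real.exp (-K * t) * (-K * 1)) t :=
      ((hasDerivAt_id t).const_mul (-K)).exp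
    refine (h1.mul ((hE' t ht).add_const D)).congr_deriv ?_
    ring
  have hanti : AntitoneOn (fun t => Real.exp (-K * t) * (E t + D)) (Set.Icc 0 T) := by
    apply antitoneOn_of_deriv_nonpos (convex_Icc 0 T)
    · exact ContinuousOn.mul (Continuous.continuousOn (by fun_prop)) (hE.add continuousOn_const)
    · rw [interior_Icc]
      exact fun t ht => (hd t ht).differentiableAt.differentiableWithinAt
    · rw [interior_Icc]
      intro t ht
      rw [(hd t ht).deriv]
      exact mul_nonpos_of_nonneg_of_nonpos (Real.exp_pos _).le (by linarith [hle t ht])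
  have := hanti ⟨le_rfl, ht.1.trans ht.2⟩ ht ht.1
  simp only [mul_zero, Real.exp_zero, one_mul] at this
  have h2 := mul_le_mul_of_nonneg_left this (Real.exp_pos (K * t)).le
  rwa [← mul_assoc, ← Real.exp_add, neg_mul, add_neg_cancel, Real.exp_zero, one_mul] at h2

/-! ### Initial error and final estimate -/

theorem IsSolution.initial_ref {a b T : ℝ} (hab : a < b) {bc : BoundaryCondition} {k N : ℕ}
    [NeZero N] {C c₀ : ℝ} {u₀ : ℝ → ℝ} {uh : ℝ → Fin N → ℝ[X]}
    (h : IsSolution linearSquare bc k C c₀ a b T u₀ uh) (i : Fin N) (q : ℝ[X])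
    (hq : q.natDegree ≤ k) :
    ∫ s in (0 : ℝ)..1, (toRef a b i (uh 0 i)).eval s * q.eval s =
      ∫ s in (0 : ℝ)..1, u₀ (xL a b i + meshSize a b N * s) * q.eval s := by
  have hh := (meshSize_pos hab N).ne'
  obtain ⟨φ, hφ, rfl⟩ := exists_toRef_eq hh i hq
  have := h.initial i φ hφ
  rw [integral_cell, integral_cell] at this
  simpa only [eval_toRef] using mul_left_cancel₀ hh this

/-- The difference of the Gauss-Radau and the `L²` projections of the initial value. -/
theorem pairing_self_le_of_projection {k : ℕ} {g : ℝ → ℝ} (hg : Continuous g) {W : ℝ[X]}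
    (hW : W.natDegree ≤ k)
    (hproj : ∀ q : ℝ[X], q.natDegree ≤ k →
      ∫ s in (0 : ℝ)..1, W.eval s * q.eval s = ∫ s in (0 : ℝ)..1, g s * q.eval s) {ε : ℝ}
    (hε : ∀ s ∈ Set.Icc (0 : ℝ) 1, |(radau k g).eval s - g s| ≤ ε) :
    pairing (radau k g - W) (radau k g - W) ≤ ε ^ 2 := by
  set ξ := radau k g - W with hξ
  have hξk : ξ.natDegree ≤ k := by
    simpa using natDegree_sub_le_of_le (natDegree_radau_le k g) hW
  -- The `L²` projection error `g - W` is orthogonal to `ξ`.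
  have h1 : pairing ξ ξ = ∫ s in (0 : ℝ)..1, ((radau k g).eval s - g s) * ξ.eval s := by
    have h2 := hproj ξ hξk
    have h3 : pairing ξ ξ + ∫ s in (0 : ℝ)..1, W.eval s * ξ.eval s =
        (∫ s in (0 : ℝ)..1, ((radau k g).eval s - g s) * ξ.eval s) +
          ∫ s in (0 : ℝ)..1, g s * ξ.eval s := by
      rw [pairing_apply, ← intervalIntegral.integral_add, ← intervalIntegral.integral_add]
      · congr 1; funext s
        have : ξ.eval s = (radau k g).eval s - W.eval s := by rw [hξ, eval_sub]
        rw [this]; ring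
      all_goals exact Continuous.intervalIntegrable (by fun_prop) _ _
    linarith
  have hc : Continuous fun s => (radau k g).eval s - g s := by fun_prop
  have h4 := (le_abs_self _).trans (abs_integral_mul_le hc ξ.continuous hε)
  rw [← h1, ← pairing_self] at h4
  have h5 := Real.sq_sqrt (pairing_self_nonneg ξ)
  have h6 := Real.sqrt_nonneg (pairing ξ ξ)
  nlinarith [sq_nonneg (ε - Real.sqrt (pairing ξ ξ))]

theorem integral_sq_sub_le {g : ℝ → ℝ} (hg : Continuous g) {p W : ℝ[X]} {ε : ℝ}
    (hε : ∀ s ∈ Set.Icc (0 : ℝ) 1, |p.eval s - g s| ≤ ε) :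
    ∫ s in (0 : ℝ)..1, (g s - W.eval s) ^ 2 ≤ 2 * ε ^ 2 + 2 * pairing (p - W) (p - W) := by
  have h : ∫ s in (0 : ℝ)..1, (g s - W.eval s) ^ 2 ≤
      ∫ s in (0 : ℝ)..1, (2 * ε ^ 2 + 2 * (p - W).eval s ^ 2) := by
    apply intervalIntegral.integral_mono_on zero_le_one
    · exact Continuous.intervalIntegrable (by fun_prop) _ _
    · exact Continuous.intervalIntegrable (by fun_prop) _ _
    · intro s hs
      have h1 : (p.eval s - g s) ^ 2 ≤ ε ^ 2 := by
        rw [← sq_abs]; exact pow_le_pow_left₀ (abs_nonneg _) (hε s hs) 2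
      rw [eval_sub]
      nlinarith [sq_nonneg ((p.eval s - g s) + (p.eval s - W.eval s))]
  rw [intervalIntegral.integral_add (continuous_const.intervalIntegrable _ _)
    (Continuous.intervalIntegrable (by fun_prop) _ _),
    intervalIntegral.integral_const_mul 2 fun s => (p - W).eval s ^ 2, ← pairing_self] at h
  simpa using h

theorem l2Error_sq_le {a b : ℝ} (hab : a < b) {N : ℕ} [NeZero N] {G : ℝ → ℝ} {w p : Fin N → ℝ[X]}
    (hG : Continuous G) {ε : ℝ}
    (hε : ∀ i, ∀ s ∈ Set.Icc (0 : ℝ) 1,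
      |(p i).eval s - G (xL a b i + meshSize a b N * s)| ≤ ε) :
    l2Error a b G w ^ 2 ≤ 2 * (b - a) * ε ^ 2 + 2 * meshSize a b N *
      ∑ i, pairing (p i - toRef a b i (w i)) (p i - toRef a b i (w i)) := by
  have hh := meshSize_pos hab N
  have hle : ∑ i : Fin N, ∫ x in (xL a b i)..(xR a b i), (G x - (w i).eval x) ^ 2 ≤
      ∑ i : Fin N, meshSize a b N *
        (2 * ε ^ 2 + 2 * pairing (p i - toRef a b i (w i)) (p i - toRef a b i (w i))) := by
    refine Finset.sum_le_sum fun i _ => ?_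
    rw [integral_cell]
    refine mul_le_mul_of_nonneg_left ?_ hh.le
    have hc : Continuous fun s => G (xL a b i + meshSize a b N * s) := by fun_prop
    have := integral_sq_sub_le (W := toRef a b i (w i)) hc (hε i)
    simpa only [eval_toRef] using this
  have h0 : 0 ≤ ∑ i : Fin N, ∫ x in (xL a b i)..(xR a b i), (G x - (w i).eval x) ^ 2 := by
    refine Finset.sum_nonneg fun i _ => intervalIntegral.integral_nonneg ?_ fun x _ => sq_nonneg _
    rw [xR_eq]; linarith
  rw [l2Error, Real.sq_sqrt h0]
  refine hle.trans (le_of_eq ?_)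
  rw [← Finset.mul_sum, Finset.sum_add_distrib, ← Finset.mul_sum, ← card_mul_meshSize a b N,
    Finset.sum_const, Finset.card_univ, Fintype.card_fin, nsmul_eq_mul, ← Finset.mul_sum]
  ring

/-- Time derivative of the discrete solution in the reference variable. -/
theorem IsSolution.exists_deriv_toRef {a b T : ℝ} {bc : BoundaryCondition} {k N : ℕ} [NeZero N]
    {C c₀ : ℝ} {u₀ : ℝ → ℝ} {uh : ℝ → Fin N → ℝ[X]}
    (h : IsSolution linearSquare bc k C c₀ a b T u₀ uh) {t : ℝ} (ht : t ∈ Set.Ioo 0 T)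
    (i : Fin N) : ∃ Wd : ℝ[X], Wd.natDegree ≤ k ∧
      (∀ n, HasDerivAt (fun τ => (toRef a b i (uh τ i)).coeff n) (Wd.coeff n) t) ∧
      ∀ s, derivWithin (fun τ => (toRef a b i (uh τ i)).eval s) (Set.Icc 0 T) t = Wd.eval s := by
  have hnhds : Set.Icc 0 T ∈ nhds t := Icc_mem_nhds ht.1 ht.2
  have hev : ∀ᶠ τ in nhds t, (uh τ i).natDegree ≤ k :=
    Filter.eventually_of_mem hnhds fun τ hτ => h.mem τ hτ i
  have hdiff : ∀ n, DifferentiableAt ℝ (fun τ => (toRef a b i (uh τ i)).coeff n) t := by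
    intro n
    have hev' : (fun τ => (toRef a b i (uh τ i)).coeff n) =ᶠ[nhds t] fun τ =>
        ∑ m ∈ Finset.range (k + 1), (uh τ i).coeff m *
          ((Polynomial.C (xL a b i) + Polynomial.C (meshSize a b N) * X : ℝ[X]) ^ m).coeff n :=
      hev.mono fun τ hτ => coeff_toRef a b i hτ n
    rw [hev'.differentiableAt_iff]
    exact DifferentiableAt.fun_sum fun m _ =>
      ((h.differentiable i m).differentiableAt hnhds).mul_const _
  -- The derivative polynomial is assembled from coefficient derivatives; those beyond degree `k`
  -- vanish near `t`.
  let Wd : ℝ[X] := ∑ n ∈ Finset.range (k + 1),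
    Polynomial.C (deriv (fun τ => (toRef a b i (uh τ i)).coeff n) t) * X ^ n
  have hWdk : Wd.natDegree ≤ k := natDegree_sum_le_of_forall_le _ _ fun n hn =>
    (natDegree_C_mul_X_pow_le _ _).trans (Nat.lt_succ_iff.mp (Finset.mem_range.mp hn))
  have hcoeff : ∀ n, Wd.coeff n = deriv (fun τ => (toRef a b i (uh τ i)).coeff n) t := by
    intro n
    by_cases hn : n ≤ k
    · simp [Wd, finsetSum_coeff, coeff_C_mul, coeff_X_pow, hn]
    · have hz : (fun τ => (toRef a b i (uh τ i)).coeff n) =ᶠ[nhds t] fun _ => 0 :=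
        hev.mono fun τ hτ => coeff_eq_zero_of_natDegree_lt
          (lt_of_le_of_lt (natDegree_toRef_le a b i hτ) (not_le.mp hn))
      rw [hz.deriv_eq, coeff_eq_zero_of_natDegree_lt (lt_of_le_of_lt hWdk (not_le.mp hn))]
      simp
  have hd : ∀ n, HasDerivAt (fun τ => (toRef a b i (uh τ i)).coeff n) (Wd.coeff n) t := by
    intro n
    rw [hcoeff]
    exact (hdiff n).hasDerivAt
  refine ⟨Wd, hWdk, hd, fun s => ?_⟩
  have hsum : HasDerivAt (fun τ => ∑ n ∈ Finset.range (k + 1),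
      (toRef a b i (uh τ i)).coeff n * s ^ n) (∑ n ∈ Finset.range (k + 1), Wd.coeff n * s ^ n) t :=
    HasDerivAt.fun_sum fun n _ => (hd n).mul_const _
  have heval : (fun τ => (toRef a b i (uh τ i)).eval s) =ᶠ[nhds t] fun τ =>
      ∑ n ∈ Finset.range (k + 1), (toRef a b i (uh τ i)).coeff n * s ^ n :=
    hev.mono fun τ hτ => eval_eq_sum_range' (Nat.lt_succ_of_le (natDegree_toRef_le a b i hτ)) s
  rw [derivWithin_of_mem_nhds hnhds, heval.deriv_eq, hsum.deriv,
    eval_eq_sum_range' (Nat.lt_succ_of_le hWdk)]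

theorem IsSolution.continuousOn_coeff_toRef {a b T : ℝ} {bc : BoundaryCondition} {k N : ℕ}
    [NeZero N] {C c₀ : ℝ} {u₀ : ℝ → ℝ} {uh : ℝ → Fin N → ℝ[X]}
    (h : IsSolution linearSquare bc k C c₀ a b T u₀ uh) (i : Fin N) (n : ℕ) :
    ContinuousOn (fun τ => (toRef a b i (uh τ i)).coeff n) (Set.Icc 0 T) := by
  refine ContinuousOn.congr (f := fun τ => ∑ m ∈ Finset.range (k + 1), (uh τ i).coeff m *
    ((Polynomial.C (xL a b i) + Polynomial.C (meshSize a b N) * X : ℝ[X]) ^ m).coeff n) ?_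
    fun τ hτ => coeff_toRef a b i (h.mem τ hτ i) n
  exact continuousOn_finsetSum _ fun m _ =>
    (h.differentiable i m).continuousOn.mul continuousOn_const

end NOESDG

/-! ### Grönwall's inequality and the final error estimate -/

open NOESDG in
theorem mainTheorem2 (a b : ℝ) (hab : a < b) (k : ℕ) (C c₀ T : ℝ) (hC : 1 < C) (hc₀ : 0 ≤ c₀)
    (hT : 0 < T) (bc : NOESDG.BoundaryCondition) (u : ℝ → ℝ → ℝ)
    (hu : NOESDG.IsSmoothSolution NOESDG.linearSquare.f a b T bc u) :
    ∃ M : ℝ, 0 < M ∧ ∀ (N : ℕ) [NeZero N] (uh : ℝ → Fin N → Polynomial ℝ),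
      NOESDG.IsSolution NOESDG.linearSquare bc k C c₀ a b T (fun x => u x 0) uh →
      ∀ t ∈ Set.Icc 0 T,
        NOESDG.l2Error a b (fun x => u x t) (uh t) ≤ M * NOESDG.meshSize a b N ^ (k + 1) := by
  have hg : ContDiff ℝ ∞ fun x => u x 0 := hu.contDiff_initial hT.le
  set g : ℝ → ℝ := fun x => u x 0 with hgdef
  have hut : ∀ t ∈ Set.Icc 0 T, (fun x => u x t) = fun x => g (x - t) := fun t ht =>
    funext fun x => hu.eq_initial x ht
  have hGt : ∀ t, ContDiff ℝ ∞ fun x => g (x - t) := fun t =>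
    hg.comp (contDiff_id.sub contDiff_const)
  obtain ⟨B, hB0, hB⟩ := exists_iteratedDeriv_bound hg a b T (k + 2)
  have hB' : ∀ t ∈ Set.Icc 0 T, ∀ l ≤ k + 2, ∀ x ∈ Set.Icc a b,
      |iteratedDeriv l (fun x => g (x - t)) x| ≤ B := fun t ht l hl x hx => by
    rw [iteratedDeriv_comp_sub_const]; exact hB l hl x hx t ht
  obtain ⟨KR, hKR0, hKR⟩ := exists_cellProj_error k hab
  obtain ⟨K, hK0, hK⟩ := exists_energy_rate hab k hC hc₀ hB0
  -- Projection error plus `2 h E(t)`. The exponent `2K` reflects the derivative of a square, and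
  -- `(KR * B)² + 1` collects the initial energy and the source, both relative to `N δ²`.
  set M2 := 2 * (b - a) * (KR * B) ^ 2 +
    2 * (b - a) * (Real.exp (2 * K * T) * ((KR * B) ^ 2 + 1)) with hM2
  have hba : 0 < b - a := by linarith
  have hM20 : 0 ≤ M2 := by positivity
  refine ⟨Real.sqrt M2 + 1, by positivity, fun N _ uh hsol t ht => ?_⟩
  have hh := meshSize_pos hab N
  set h := meshSize a b N with hhdef
  set δ := h ^ (k + 1) with hδ
  have hδ0 : 0 ≤ δ := by positivity
  let ξ : Fin N → ℝ → Polynomial ℝ := fun i τ =>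
    cellProj k a b i (fun x => g (x - τ)) - toRef a b i (uh τ i)
  have hξk : ∀ i, ∀ τ ∈ Set.Icc 0 T, (ξ i τ).natDegree ≤ k := fun i τ hτ => by
    simpa using Polynomial.natDegree_sub_le_of_le
      (natDegree_cellProj_le k a b i fun x => g (x - τ)) (natDegree_toRef_le a b i (hsol.mem τ hτ i))
  have hproj : ∀ (i : Fin N) n τ, HasDerivAt (fun τ => (cellProj k a b i (fun x => g (x - τ))).coeff n)
      ((cellProj k a b i (fun x => -deriv (fun x => g (x - τ)) x)).coeff n) τ := by
    intro i n τ
    have := hasDerivAt_coeff_radau k hg n (xL a b i) h τ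
    simp only [deriv_comp_sub_const]
    exact this
  set E : ℝ → ℝ := fun τ => ∑ i, pairing (ξ i τ) (ξ i τ) with hE
  have hEcont : ContinuousOn E (Set.Icc 0 T) := by
    refine continuousOn_finsetSum _ fun i _ => continuousOn_pairing_self (hξk i) fun n => ?_
    simp only [ξ, Polynomial.coeff_sub]
    exact ContinuousOn.sub (fun τ _ => (hproj i n τ).continuousAt.continuousWithinAt)
      (hsol.continuousOn_coeff_toRef i n)
  have hrate : ∀ τ ∈ Set.Ioo 0 T, ∃ E' : ℝ, HasDerivAt E E' τ ∧
      E' ≤ 2 * K * (E τ + N * δ ^ 2) := by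
    intro τ hτ
    have hτ' : τ ∈ Set.Icc 0 T := ⟨hτ.1.le, hτ.2.le⟩
    choose Wd hWdk hWd hWds using fun i => hsol.exists_deriv_toRef hτ i (a := a) (b := b)
    refine ⟨∑ i, 2 * pairing (cellProj k a b i (fun x => -deriv (fun x => g (x - τ)) x) - Wd i)
      (ξ i τ), ?_, ?_⟩
    · refine HasDerivAt.fun_sum fun i _ => hasDerivAt_pairing_self (k := k) ?_ ?_ fun n => ?_
      · exact Filter.eventually_of_mem (Icc_mem_nhds hτ.1 hτ.2) (hξk i)
      · simpa using Polynomial.natDegree_sub_le_of_le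
          (natDegree_cellProj_le k a b i fun x => -deriv (fun x => g (x - τ)) x) (hWdk i)
      · simp only [ξ, Polynomial.coeff_sub]
        exact (hproj i n τ).sub (hWd i n)
    · have := hK bc (fun x => g (x - τ)) (hGt τ) (hB' τ hτ')
        (fun l => by rw [← hut τ hτ']; exact hu.boundaryCompatible hτ' l) N (uh τ) Wd
        (fun i => ξ i τ) (hsol.mem τ hτ') (fun i => rfl)
        (fun i q hq => hsol.scheme_ref hab hτ' i (hWds i) q hq)
      rw [← Finset.mul_sum, mul_assoc]
      exact mul_le_mul_of_nonneg_left this zero_le_two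
  choose! E' hE' hEle using hrate
  have hgron := le_exp_mul_of_deriv_le hEcont hE' hEle ht
  have hE0 : E 0 ≤ N * (KR * B * δ) ^ 2 := by
    have h0 : (0 : ℝ) ∈ Set.Icc 0 T := ⟨le_rfl, hT.le⟩
    calc E 0 ≤ ∑ _i : Fin N, (KR * B * δ) ^ 2 := by
          refine Finset.sum_le_sum fun i _ => ?_
          have hc : Continuous fun s => g (xL a b i + h * s - 0) := by
            have := hg.continuous; fun_prop
          refine pairing_self_le_of_projection (k := k) hc
            (natDegree_toRef_le a b i (hsol.mem 0 h0 i)) (fun q hq => ?_) (fun s hs => ?_)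
          · simpa only [sub_zero] using hsol.initial_ref hab i q hq
          · simpa [cellProj] using hKR _ (hGt 0) B (hB' 0 h0 (k + 1) (by omega)) N i 0
              (Nat.zero_le _) s hs
      _ = N * (KR * B * δ) ^ 2 := by simp
  have hexp : Real.exp (2 * K * t) ≤ Real.exp (2 * K * T) :=
    Real.exp_le_exp.mpr (mul_le_mul_of_nonneg_left ht.2 (by positivity))
  have hEt : E t ≤ Real.exp (2 * K * T) * ((KR * B) ^ 2 + 1) * (N * δ ^ 2) := by
    have hN : 0 ≤ (N : ℝ) * δ ^ 2 := by positivity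
    calc E t ≤ Real.exp (2 * K * t) * (E 0 + N * δ ^ 2) := by linarith
      _ ≤ Real.exp (2 * K * t) * (((KR * B) ^ 2 + 1) * (N * δ ^ 2)) := by
          refine mul_le_mul_of_nonneg_left ?_ (Real.exp_pos _).le
          nlinarith
      _ ≤ Real.exp (2 * K * T) * (((KR * B) ^ 2 + 1) * (N * δ ^ 2)) :=
          mul_le_mul_of_nonneg_right hexp (by positivity)
      _ = _ := by ring
  have herr : l2Error a b (fun x => u x t) (uh t) ^ 2 ≤ M2 * δ ^ 2 := by
    rw [hut t ht]
    have := l2Error_sq_le hab (w := uh t) (p := fun i => cellProj k a b i fun x => g (x - t))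
      (hGt t).continuous (ε := KR * B * δ) (fun i s hs => by
        simpa using hKR _ (hGt t) B (hB' t ht (k + 1) (by omega)) N i 0 (Nat.zero_le _) s hs)
    refine this.trans ?_
    have h2 : 2 * h * E t ≤
        2 * h * (Real.exp (2 * K * T) * ((KR * B) ^ 2 + 1) * (N * δ ^ 2)) :=
      mul_le_mul_of_nonneg_left hEt (by positivity)
    -- The identity `N h = b - a` removes the dependence on the number of cells.
    have h3 : 2 * h * (Real.exp (2 * K * T) * ((KR * B) ^ 2 + 1) * (N * δ ^ 2)) =
        2 * (b - a) * (Real.exp (2 * K * T) * ((KR * B) ^ 2 + 1)) * δ ^ 2 := by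
      rw [← card_mul_meshSize a b N]; ring
    rw [h3] at h2
    refine (add_le_add_right h2 _).trans (le_of_eq ?_)
    rw [hM2]; ring
  have hs : l2Error a b (fun x => u x t) (uh t) ≤ Real.sqrt (M2 * δ ^ 2) := Real.le_sqrt_of_sq_le herr
  rw [Real.sqrt_mul hM20, Real.sqrt_sq hδ0] at hs
  nlinarith
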